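/- **Model.** There are $N$ transmitter–receiver pairs; transmitters have $N_t$ antennas, receivers $N_r$, and each pair has $d\ge 1$ data streams. Let $P,\zeta,\sigma,R>0$ be the transmit power, the common path loss coefficient, the noise standard deviation and the rate of a successful stream, let $\tau\ge 0$ be the SINR threshold, and put $\alpha=P\zeta/d$. Let $\theta>0$ with $N\theta<1$ be the fraction of a slot needed to acquire the channel state of one user. Time is slotted. In every slot the matrices $H_{ki}\in\mathbb C^{N_r\times N_t}$ ($1\le k,i\le N$) have i.i.d. circularly symmetric complex Gaussian entries of mean $0$ and variance $1$, independently over slots. With unlimited backhaul, a set $\mathcal L$ of active pairs, with $L=|\mathcal L|$, uses precoders $v_i^{(j)}$ that are orthonormal in $j$ and unit combiners $u_k^{(m)}$ (measurable functions of the channels) satisfying almost surely the interference alignment conditions $(u_k^{(m)})^{H}H_{ki}v_i^{(j)}=0$ for all $i,k\in\mathcal L$ and $(i,j)\ne(k,m)$; such a scheme is assumed to exist, and is fixed, for every $\mathcal L$. The precoders are computed from the cross links $H_{ki}$, $k\neq i$ in $\mathcal L$, only. The combiner $u_k^{(m)}$ is computed from these and from the vectors $H_{kk}v_k^{(j)}$,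 $j\ne m$, only. The SINR of stream $m$ of user $k\in\mathcal L$ is $$\gamma_k^{(m)}=\frac{\alpha\,|(u_k^{(m)})^{H}H_{kk}v_k^{(m)}|^2}{\sigma^2+\sum_{i\in\mathcal L,\ (i,j)\neq(k,m)}\alpha\,|(u_k^{(m)})^{H}H_{ki}v_i^{(j)}|^2}.$$ User $k$ is offered $B_k=(1-L\theta)\,R\cdot\#\{m:\gamma_k^{(m)}\ge\tau\}$ bits in the slot if $k\in\mathcal L$, and $B_k=0$ otherwise. The queues start from some fixed $q(0)\in\mathbb R_{\ge0}^N$ and evolve by $$q_k(t+1)=\max\{q_k(t)-B_k(t),0\}+A_k(t).$$ The arrivals $A_k(t)\geq 0$ are bounded, i.i.d. in time, independent across users and of the channels, with mean vector $a=(\mathbb E A_k)_k$. A centralized policy chooses the active set of slot $t$ from the queue lengths up to time $t$, possibly with randomization, measurably. The system is strongly stable if $\limsup_{T}\frac1T\sum_{t<T}\mathbb E\,q_k(t)<\infty$ for every $k$. The stability region $\Lambda$ is the set of $a\in\mathbb R_{\ge 0}^N$ such that, for every arrival law with mean $a$, some centralized policy makes the system strongly stable. **Definitions.** Let $\mu(L)=(1-L\theta)\,dR\,e^{-\sigma^2\tau/\alpha}$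 and $\mu_T(L)=L\mu(L)$. Let $L_P=\lceil 1/(2\theta)\rceil$ if $\mu_T(\lceil 1/(2\theta)\rceil)\ge\mu_T(\lfloor 1/(2\theta)\rfloor)$, and $L_P=\lfloor 1/(2\theta)\rfloor$ otherwise. Let $P_L=\{\mu(L)s: s\in\{0,1\}^N,\ \|s\|_1=L\}$ (so $P_0=\{0\}$, and $P_L=\emptyset$ for $L>N$), and let $$\Lambda_P=\mathcal{CH}\{P_0,P_1,\dots,P_{L_P}\},$$ where $\mathcal{CH}$ denotes the closed convex hull. **Theorem.** For the symmetric system with unlimited backhaul the stability region is $\Lambda_P$, up to its boundary. Precisely: 1. the closure of $\Lambda$ is $\Lambda_P$; 2. every $a\in\mathbb R_{\ge0}^N$ that is interior to $\Lambda_P$ relative to $\mathbb R_{\ge0}^N$ belongs to $\Lambda$; 3. conversely, if for some arrival law some centralized policy makes the system strongly stable, then the mean vector of that law belongs to $\Lambda_P$. -/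

import Mathlib

open MeasureTheory ProbabilityTheory Filter Topology

namespace IAStability

noncomputable section

/-! ## Parameters of the symmetric system -/

/-- The parameters of the symmetric MIMO interference network. -/
structure SymmetricSystem where
  /-- maximum number of transmitter-receiver pairs -/
  N : ℕ
  /-- antennas at each transmitter -/
  Nt : ℕ
  /-- antennas at each receiver -/
  Nr : ℕ
  /-- data streams of each pair -/
  d : ℕ
  /-- total power of each transmitter -/
  P : ℝ
  /-- common path loss coefficient -/
  ζ : ℝ
  /-- standard deviation of the noise -/
  σ : ℝ
  /-- fraction of a slot spent to acquire the channel state information of one user -/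
  θ : ℝ
  /-- SINR threshold -/
  τ : ℝ
  /-- rate assigned to a stream whose SINR reaches the threshold -/
  R : ℝ
  d_pos : 0 < d
  P_pos : 0 < P
  ζ_pos : 0 < ζ
  σ_pos : 0 < σ
  θ_pos : 0 < θ
  τ_nonneg : 0 ≤ τ
  R_pos : 0 < R
  Nθ_lt_one : N * θ < 1

namespace SymmetricSystem

variable (M : SymmetricSystem)

/-- `α = P ζ / d`, the received power per stream. -/
def α : ℝ := M.P * M.ζ / M.d

/-! ## Channels -/

/-- All channel matrices of one slot: `H k i` is the `Nr × Nt` matrix from transmitter `i` to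
receiver `k`. -/
abbrev Channel : Type := Fin M.N → Fin M.N → Fin M.Nr → Fin M.Nt → ℂ

end SymmetricSystem

/-- The circularly symmetric complex Gaussian law with zero mean and unit variance. -/
def complexGaussian : Measure ℂ :=
  ((gaussianReal 0 (1 / 2)).prod (gaussianReal 0 (1 / 2))).map Complex.measurableEquivRealProd.symm

instance : IsProbabilityMeasure complexGaussian :=
  Measure.isProbabilityMeasure_map Complex.measurableEquivRealProd.symm.measurable.aemeasurable

namespace SymmetricSystem

variable (M : SymmetricSystem)

/-- All entries of all channel matrices are i.i.d. standard complex Gaussian. -/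
def channelLaw : Measure M.Channel :=
  Measure.pi fun _ => Measure.pi fun _ => Measure.pi fun _ => Measure.pi fun _ => complexGaussian

instance : IsProbabilityMeasure M.channelLaw := by
  unfold channelLaw; infer_instance

/-- The scalar `uᴴ G v`. -/
def gain (u : Fin M.Nr → ℂ) (G : Fin M.Nr → Fin M.Nt → ℂ) (v : Fin M.Nt → ℂ) : ℂ :=
  star u ⬝ᵥ (Matrix.of G).mulVec v

/-! ## Interference alignment with perfect channel knowledge -/

/-- An interference alignment scheme under unlimited backhaul. For every set `ℒ` of active pairs
and every realization `H` of the channels it provides the precoders `v ℒ H i j` and the combiners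
`u ℒ H k m`, for transmitter `i`, receiver `k` and streams `j`, `m`. -/
structure IAScheme where
  v : Finset (Fin M.N) → M.Channel → Fin M.N → Fin M.d → Fin M.Nt → ℂ
  u : Finset (Fin M.N) → M.Channel → Fin M.N → Fin M.d → Fin M.Nr → ℂ
  measurable_v : ∀ ℒ i j, Measurable fun H => v ℒ H i j
  measurable_u : ∀ ℒ k m, Measurable fun H => u ℒ H k m
  /-- the precoders of one transmitter are orthonormal (in particular of unit norm) -/
  orthonormal_v : ∀ ℒ H, ∀ i ∈ ℒ, ∀ j j',
    star (v ℒ H i j) ⬝ᵥ v ℒ H i j' = if j = j' then 1 else 0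
  /-- the combiners have unit norm -/
  unit_u : ∀ ℒ H, ∀ k ∈ ℒ, ∀ m, star (u ℒ H k m) ⬝ᵥ u ℒ H k m = 1
  /-- the alignment conditions: inter-stream and inter-user interference vanish -/
  aligned : ∀ ℒ, ∀ᵐ H ∂M.channelLaw, ∀ k ∈ ℒ, ∀ i ∈ ℒ, ∀ m j, (i, j) ≠ (k, m) →
    M.gain (u ℒ H k m) (H k i) (v ℒ H i j) = 0
  /-- the direct links do not enter in the computation of the precoders, which depends only on
  the cross links between active pairs -/
  v_congr : ∀ ℒ H H', (∀ k ∈ ℒ, ∀ i ∈ ℒ, k ≠ i → H k i = H' k i) →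
    ∀ i ∈ ℒ, ∀ j, v ℒ H i j = v ℒ H' i j
  /-- the direct link of receiver `k` enters in its zero-forcing combiner for stream `m` only
  through the directions in which the other streams of the same pair are received -/
  u_congr : ∀ ℒ H H', (∀ k ∈ ℒ, ∀ i ∈ ℒ, k ≠ i → H k i = H' k i) →
    ∀ k ∈ ℒ, ∀ m,
      (∀ j, j ≠ m →
        (Matrix.of (H k k)).mulVec (v ℒ H k j) = (Matrix.of (H' k k)).mulVec (v ℒ H k j)) →
      u ℒ H k m = u ℒ H' k m

variable {M}

namespace IAScheme

variable (S : M.IAScheme)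

/-- The SINR `γ_k^(m)` of stream `m` at the active receiver `k`. -/
def sinr (ℒ : Finset (Fin M.N)) (H : M.Channel) (k : Fin M.N) (m : Fin M.d) : ℝ :=
  M.α * ‖M.gain (S.u ℒ H k m) (H k k) (S.v ℒ H k m)‖ ^ 2 /
    (M.σ ^ 2 + ∑ i ∈ ℒ, ∑ j : Fin M.d,
      if (i, j) = (k, m) then 0
      else M.α * ‖M.gain (S.u ℒ H k m) (H k i) (S.v ℒ H i j)‖ ^ 2)

open Classical in
/-- `B_k`, the number of bits of user `k` that can be served in a slot with active set `ℒ` and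
channels `H`: the fraction `1 - |ℒ| θ` of the slot is left for transmission, and each stream
carries rate `R` if its SINR reaches the threshold, and `0` otherwise. -/
def service (ℒ : Finset (Fin M.N)) (H : M.Channel) (k : Fin M.N) : ℝ :=
  if k ∈ ℒ then
    (1 - ℒ.card * M.θ) * ∑ m : Fin M.d, if M.τ ≤ S.sinr ℒ H k m then M.R else 0
  else 0

end IAScheme

/-! ## Arrivals, scheduling policies and queues -/

end SymmetricSystem

/-- The laws of the numbers of bits that arrive in one slot for each of the `N` users; they are
nonnegative and bounded. The arrivals are independent across users. -/
structure ArrivalLaw (N : ℕ) where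
  law : Fin N → Measure ℝ
  prob : ∀ k, IsProbabilityMeasure (law k)
  bounded : ∃ Amax : ℝ, ∀ k, ∀ᵐ x ∂law k, 0 ≤ x ∧ x < Amax

namespace ArrivalLaw

variable {N : ℕ} (A : ArrivalLaw N)

instance (k : Fin N) : IsProbabilityMeasure (A.law k) := A.prob k

/-- The vector of mean arrival rates, in bits per slot. -/
def mean (k : Fin N) : ℝ := ∫ x, x ∂A.law k

end ArrivalLaw

/-- A centralized scheduling policy. At slot `t` it selects the set of active pairs from the queue
lengths at the slots `0, …, t` and a random seed. -/
structure Policy (N : ℕ) where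
  select : (t : ℕ) → (Fin (t + 1) → Fin N → ℝ) → unitInterval → Finset (Fin N)
  measurable_select : ∀ t, Measurable fun x : (Fin (t + 1) → Fin N → ℝ) × unitInterval =>
    select t x.1 x.2

namespace SymmetricSystem

variable {M : SymmetricSystem}

/-- The randomness of one slot: arrivals, channels, and the seed of the policy. -/
abbrev Slot (M : SymmetricSystem) : Type := (Fin M.N → ℝ) × M.Channel × unitInterval

/-- Arrivals, channels and seed of a slot are independent. -/
def slotLaw (A : ArrivalLaw M.N) : Measure M.Slot :=
  (Measure.pi A.law).prod (M.channelLaw.prod volume)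

instance (A : ArrivalLaw M.N) : IsProbabilityMeasure (slotLaw A) := by
  unfold slotLaw; infer_instance

/-- The slots are i.i.d. -/
def pathLaw (A : ArrivalLaw M.N) : Measure (ℕ → M.Slot) :=
  Measure.infinitePi fun _ => slotLaw A

namespace IAScheme

variable (S : M.IAScheme)

/-- The queue lengths at the slots `0, …, t`, started from `q₀`, which evolve by
`q_k(t+1) = max {q_k(t) - B_k(t), 0} + A_k(t)`. -/
def history (π : Policy M.N) (q₀ : Fin M.N → ℝ) (ω : ℕ → M.Slot) :
    (t : ℕ) → Fin (t + 1) → Fin M.N → ℝ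
  | 0 => fun _ => q₀
  | t + 1 =>
    let h := history π q₀ ω t
    let ℒ := π.select t h (ω t).2.2
    Fin.snoc (α := fun _ => Fin M.N → ℝ) h fun k =>
      max (h (Fin.last t) k - S.service ℒ (ω t).2.1 k) 0 + (ω t).1 k

/-- The queue length vector at slot `t`. -/
def queue (π : Policy M.N) (q₀ : Fin M.N → ℝ) (ω : ℕ → M.Slot) (t : ℕ) : Fin M.N → ℝ :=
  S.history π q₀ ω t (Fin.last t)

/-- Strong stability: `limsup_T (1/T) ∑_{t<T} E[q_k(t)] < ∞` for every user `k`. -/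
def StronglyStable (A : ArrivalLaw M.N) (q₀ : Fin M.N → ℝ) (π : Policy M.N) : Prop :=
  ∀ k, limsup (fun T : ℕ => (∑ t ∈ Finset.range T,
    ∫⁻ ω, ENNReal.ofReal (S.queue π q₀ ω t k) ∂pathLaw A) / (T : ENNReal)) atTop < ⊤

/-- Some centralized policy makes all queues strongly stable under the arrival law `A`. -/
def Stabilizable (q₀ : Fin M.N → ℝ) (A : ArrivalLaw M.N) : Prop :=
  ∃ π : Policy M.N, S.StronglyStable A q₀ π

/-- The set of mean arrival rate vectors for which all the queues can be made strongly stable,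
whatever the arrival law with these means. -/
def stabilityRegion (q₀ : Fin M.N → ℝ) : Set (Fin M.N → ℝ) :=
  {a | (∀ k, 0 ≤ a k) ∧ ∀ A : ArrivalLaw M.N, A.mean = a → S.Stabilizable q₀ A}

end IAScheme

/-! ## The characterization -/

variable (M)

/-- `μ(L) = (1 - L θ) d R exp(-σ² τ / α)`. -/
def μ (L : ℕ) : ℝ := (1 - L * M.θ) * M.d * M.R * Real.exp (-(M.σ ^ 2 * M.τ / M.α))

/-- `μ_T(L) = L μ(L)`. -/
def μT (L : ℕ) : ℝ := L * M.μ L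

/-- The best of the two integers next to `1 / (2 θ)`. -/
def LP : ℕ :=
  if M.μT ⌊1 / (2 * M.θ)⌋₊ ≤ M.μT ⌈1 / (2 * M.θ)⌉₊ then ⌈1 / (2 * M.θ)⌉₊ else ⌊1 / (2 * M.θ)⌋₊

/-- `S_L`, the decision vectors `s ∈ {0,1}^N` with `‖s‖₁ = L`. -/
def decisions (L : ℕ) : Set (Fin M.N → ℝ) :=
  {s | (∀ k, s k = 0 ∨ s k = 1) ∧ ∑ k, |s k| = L}

/-- `P_L = {μ(L) s : s ∈ S_L}`. -/
def rateVectors (L : ℕ) : Set (Fin M.N → ℝ) := (fun s => M.μ L • s) '' M.decisions L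

/-- `Λ_P`, the closed convex hull of `P_0 = {0}, P_1, …, P_{L_P}`. -/
def regionP : Set (Fin M.N → ℝ) := closedConvexHull ℝ (⋃ L ∈ Set.Iic M.LP, M.rateVectors L)

end SymmetricSystem

end

end IAStability

/-! Alignment removes all interference, so the SINR of an active stream is α|g|²/σ² almost surely,
where g = uᴴ H_kk v is its own gain. The precoder v ignores H_kk, and the combiner u sees H_kk only
through the images of the other precoders, which are orthogonal to v. The vector H_kk v can
therefore be resampled as a fresh Gaussian vector without changing the law of the channels or moving
u and v. Since u is a unit vector, g is a standard complex Gaussian (`map_gain_direct`) and |g|² is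
exponential (`complexGaussian_tail`). Hence a user in an active set of size L has mean service μ(L),
whatever the scheme (`integral_service`).

What remains is a scheduling problem with finitely many mean rate vectors, one for each active set.
All of them lie in Λ_P (`meanRate_mem_regionP`), including those of sets larger than L_P: the total
rate μ_T is a concave quadratic in L with peak at 1/(2θ), so a large set has no larger total than
L_P users, and an equal split over many users is a mixture of equal splits over L_P of them.
Moreover Λ_P is a lower set of the orthant (`mem_regionP_of_le`).

For necessity, the expected rate vector of each slot is in Λ_P by convexity, and so is its time
average. A queue is at least its arrivals minus the offered service, and strong stability makes the
expected queues at most εT at some time T. So the mean vector minus ε is dominated by a point of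
Λ_P, and ε → 0. For sufficiency, max-weight scheduling gives the sum of squared queues a negative
drift when the mean vector has slack ε in Λ_P. Both directions use that a slot is independent of the
history before it (`integral_history_slot`), which is what replaces service by mean rate. -/

namespace IAStability

noncomputable section

/-! ### Gaussian vectors and matrices through characteristic functions -/

/-- The characteristic function of the standard complex Gaussian. -/
lemma charFunDual_complexGaussian (L : StrongDual ℝ ℂ) :
    charFunDual complexGaussian L
      = Complex.exp (-((L 1) ^ 2 + (L Complex.I) ^ 2) / 4 : ℝ) := by
  have hm : complexGaussian = ((gaussianReal 0 (1 / 2)).prod (gaussianReal 0 (1 / 2))).map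
      (Complex.equivRealProdCLM.symm : ℝ × ℝ →L[ℝ] ℂ) := by
    rw [complexGaussian]; rfl
  rw [hm, charFunDual_map, charFunDual_prod, charFunDual_eq_charFun_map_one,
    charFunDual_eq_charFun_map_one]
  -- Each real coordinate has variance 1/2, hence the exponent -t²/4.
  have key : ∀ l : StrongDual ℝ ℝ, charFun ((gaussianReal 0 (1 / 2)).map l) 1
      = Complex.exp (-(l 1) ^ 2 / 4 : ℝ) := by
    intro l
    have : (l : ℝ → ℝ) = fun x => l 1 * x := by
      ext x; rw [mul_comm, ← smul_eq_mul, ← map_smul]; simp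
    rw [this, gaussianReal_map_const_mul, charFun_gaussianReal]
    congr 1
    simp
    ring
  rw [key, key, ← Complex.exp_add, ← Complex.ofReal_add]
  congr 2
  have h1 : Complex.equivRealProdCLM.symm ((1 : ℝ), (0 : ℝ)) = 1 := by
    apply Complex.ext <;> simp
  have h2 : Complex.equivRealProdCLM.symm ((0 : ℝ), (1 : ℝ)) = Complex.I := by
    apply Complex.ext <;> simp
  simp [h1, h2]
  ring

lemma charFunDual_pi_complexGaussian {ι : Type*} [Fintype ι] [DecidableEq ι]
    (L : StrongDual ℝ (ι → ℂ)) :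
    charFunDual (Measure.pi fun _ : ι => complexGaussian) L
      = Complex.exp (-(∑ i, ((L (Pi.single i 1)) ^ 2 + (L (Pi.single i Complex.I)) ^ 2)) / 4 : ℝ) := by
  rw [charFunDual_pi]
  simp_rw [charFunDual_complexGaussian]
  rw [← Complex.exp_sum]
  congr 1
  rw [← Complex.ofReal_sum, ← Finset.sum_div, Finset.sum_neg_distrib]
  simp

/-- Every real functional is the real part of a complex-linear one. -/
lemma exists_coeff {ι : Type*} [Fintype ι] [DecidableEq ι] (L : StrongDual ℝ (ι → ℂ)) :
    ∃ c : ι → ℂ, ∀ x, L x = (∑ i, c i * x i).re := by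
  refine ⟨fun i => ⟨L (Pi.single i 1), -L (Pi.single i Complex.I)⟩, fun x => ?_⟩
  conv_lhs => rw [← Finset.univ_sum_single x]
  rw [map_sum, Complex.re_sum]
  refine Finset.sum_congr rfl fun i _ => ?_
  have : (Pi.single i (x i) : ι → ℂ)
      = (x i).re • (Pi.single i 1 : ι → ℂ) + (x i).im • (Pi.single i Complex.I : ι → ℂ) := by
    rw [← Pi.single_smul, ← Pi.single_smul, ← Pi.single_add]
    congr 1
    apply Complex.ext <;> simp
  rw [this, map_add, map_smul, map_smul]
  simp
  ring

/-- The characteristic function in complex coefficients: only ∑‖cᵢ‖² enters, so invariance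
statements reduce to identities between Hermitian norms. -/
lemma integral_exp_re_pi_complexGaussian {ι : Type*} [Fintype ι] (c : ι → ℂ) :
    ∫ x, Complex.exp (((∑ i, c i * x i).re : ℝ) * Complex.I)
      ∂(Measure.pi fun _ : ι => complexGaussian)
      = Complex.exp (-(∑ i, ‖c i‖ ^ 2) / 4 : ℝ) := by
  classical
  let L : StrongDual ℝ (ι → ℂ) :=
    Complex.reCLM.comp (∑ i, (c i) • (ContinuousLinearMap.proj i : (ι → ℂ) →L[ℝ] ℂ))
  have hL : ∀ x, L x = (∑ i, c i * x i).re := by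
    intro x; simp [L]
  have h := charFunDual_pi_complexGaussian L
  rw [charFunDual_apply] at h
  simp_rw [hL] at h
  rw [h]
  have h1 : ∀ i, (∑ j, c j * (Pi.single i 1 : ι → ℂ) j).re ^ 2
      + (∑ j, c j * (Pi.single i Complex.I : ι → ℂ) j).re ^ 2 = ‖c i‖ ^ 2 := by
    intro i
    simp [Pi.single_apply, Complex.sq_norm, Complex.normSq_apply]
    ring
  simp_rw [h1]

lemma integral_exp_re_complexGaussian (c : ℂ) :
    ∫ x, Complex.exp (((c * x).re : ℝ) * Complex.I) ∂complexGaussian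
      = Complex.exp (-(‖c‖ ^ 2) / 4 : ℝ) := by
  have h := charFunDual_complexGaussian (Complex.reCLM.comp (c • (ContinuousLinearMap.id ℝ ℂ)))
  rw [charFunDual_apply] at h
  simp at h
  simp only [Complex.mul_re]
  push_cast
  rw [h]
  congr 1
  have h2 : ((‖c‖ : ℂ)) ^ 2 = c.re * c.re + c.im * c.im := by
    rw [← Complex.ofReal_pow, Complex.sq_norm, Complex.normSq_apply]
    push_cast; rfl
  rw [h2]
  ring

/-- A unit combination of i.i.d. standard complex Gaussians is a standard complex Gaussian. -/
lemma map_combination_pi_complexGaussian {ι : Type*} [Fintype ι] (u : ι → ℂ)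
    (hu : star u ⬝ᵥ u = 1) :
    (Measure.pi fun _ : ι => complexGaussian).map (fun z => star u ⬝ᵥ z) = complexGaussian := by
  have hmeas : Measurable fun z : ι → ℂ => star u ⬝ᵥ z := by
    unfold dotProduct; fun_prop
  have hu' : ∑ i, ‖u i‖ ^ 2 = 1 := by
    have : ((∑ i, ‖u i‖ ^ 2 : ℝ) : ℂ) = 1 := by
      rw [← hu]
      push_cast
      refine Finset.sum_congr rfl fun i _ => ?_
      simp [← Complex.normSq_eq_conj_mul_self, Complex.normSq_eq_norm_sq]
    exact_mod_cast this
  have : IsProbabilityMeasure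
      ((Measure.pi fun _ : ι => complexGaussian).map (fun z => star u ⬝ᵥ z)) :=
    Measure.isProbabilityMeasure_map hmeas.aemeasurable
  refine Measure.ext_of_charFunDual ?_
  ext L
  obtain ⟨c, hc⟩ : ∃ c : ℂ, ∀ x, L x = (c * x).re := by
    refine ⟨⟨L 1, -L Complex.I⟩, fun x => ?_⟩
    have : x = x.re • (1 : ℂ) + x.im • Complex.I := by apply Complex.ext <;> simp
    conv_lhs => rw [this, map_add, map_smul, map_smul]
    simp
    ring
  rw [charFunDual_apply, charFunDual_apply, integral_map hmeas.aemeasurable (by fun_prop)]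
  simp_rw [hc]
  rw [integral_exp_re_complexGaussian]
  have : ∀ x : ι → ℂ, c * (star u ⬝ᵥ x) = ∑ i, (c * star (u i)) * x i := by
    intro x; simp [dotProduct, Finset.mul_sum, mul_assoc]
  simp_rw [this]
  rw [integral_exp_re_pi_complexGaussian]
  simp [mul_pow, ← Finset.mul_sum, hu']

/-- Replacing the component of a Gaussian row along the unit vector `w` by an independent
standard Gaussian does not change its law. -/
lemma map_replaceComponent_row {ι : Type*} [Fintype ι] (w : ι → ℂ) (hw : star w ⬝ᵥ w = 1) :
    ((Measure.pi fun _ : ι => complexGaussian).prod complexGaussian).map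
      (fun p => fun i => p.1 i + (p.2 - p.1 ⬝ᵥ w) * star (w i))
      = Measure.pi fun _ : ι => complexGaussian := by
  classical
  have hmeas : Measurable fun p : (ι → ℂ) × ℂ =>
      fun i => p.1 i + (p.2 - p.1 ⬝ᵥ w) * star (w i) := by
    unfold dotProduct; fun_prop
  have : IsProbabilityMeasure (((Measure.pi fun _ : ι => complexGaussian).prod complexGaussian).map
      (fun p => fun i => p.1 i + (p.2 - p.1 ⬝ᵥ w) * star (w i))) :=
    Measure.isProbabilityMeasure_map hmeas.aemeasurable
  refine Measure.ext_of_charFunDual ?_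
  ext L
  obtain ⟨c, hc⟩ := exists_coeff L
  rw [charFunDual_apply, charFunDual_apply, integral_map hmeas.aemeasurable (by fun_prop)]
  simp_rw [hc]
  rw [integral_exp_re_pi_complexGaussian]
  set s : ℂ := ∑ i, c i * star (w i) with hs
  -- The functional splits into a form in the old row, whose coefficients `c - s w` are orthogonal
  -- to `w`, and the form `s` in the independent new component.
  have h1 : ∀ p : (ι → ℂ) × ℂ, ∑ i, c i * (p.1 i + (p.2 - p.1 ⬝ᵥ w) * star (w i))
      = (∑ i, (c i - s * w i) * p.1 i) + s * p.2 := by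
    intro p
    have : ∑ i, c i * (p.1 i + (p.2 - p.1 ⬝ᵥ w) * star (w i))
        = (∑ i, c i * p.1 i) + (p.2 - p.1 ⬝ᵥ w) * s := by
      rw [hs, Finset.mul_sum, ← Finset.sum_add_distrib]
      exact Finset.sum_congr rfl fun i _ => by ring
    rw [this]
    simp only [sub_mul, Finset.sum_sub_distrib, dotProduct, mul_assoc, ← Finset.mul_sum]
    have : ∑ i, w i * p.1 i = ∑ i, p.1 i * w i := Finset.sum_congr rfl fun i _ => mul_comm _ _
    rw [this]; ring
  simp_rw [h1, Complex.add_re, Complex.ofReal_add, add_mul, Complex.exp_add]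
  rw [integral_prod_mul (fun x : ι → ℂ =>
    Complex.exp ((((∑ i, (c i - s * w i) * x i).re : ℝ) : ℂ) * Complex.I))
    (fun y : ℂ => Complex.exp ((((s * y).re : ℝ) : ℂ) * Complex.I)),
    integral_exp_re_pi_complexGaussian, integral_exp_re_complexGaussian, ← Complex.exp_add,
    ← Complex.ofReal_add]
  congr 2
  -- Pythagoras: `s w` is the orthogonal projection of `c` on the unit vector `w`.
  have h2 : ∑ i, ‖c i - s * w i‖ ^ 2 = ∑ i, ‖c i‖ ^ 2 - ‖s‖ ^ 2 := by
    have : ((∑ i, ‖c i - s * w i‖ ^ 2 : ℝ) : ℂ) = ((∑ i, ‖c i‖ ^ 2 - ‖s‖ ^ 2 : ℝ) : ℂ) := by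
      push_cast
      simp_rw [← Complex.conj_mul', map_sub, map_mul]
      have e : ∀ i, (starRingEnd ℂ (c i) - starRingEnd ℂ s * starRingEnd ℂ (w i)) *
          (c i - s * w i) = starRingEnd ℂ (c i) * c i - s * (starRingEnd ℂ (c i) * w i)
            - starRingEnd ℂ s * (c i * star (w i))
            + starRingEnd ℂ s * s * (star (w i) * w i) := by
        intro i; simp only [RCLike.star_def]; ring
      simp_rw [e, Finset.sum_add_distrib, Finset.sum_sub_distrib, ← Finset.mul_sum]
      rw [← hs]
      have hs' : ∑ i, starRingEnd ℂ (c i) * w i = starRingEnd ℂ s := by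
        rw [hs, map_sum]; simp
      have hw' : ∑ i, star (w i) * w i = 1 := hw
      rw [hs', hw']; ring
    exact_mod_cast this
  rw [h2]; ring

/-- Replacing the image of the unit vector `w` under a Gaussian matrix by an independent Gaussian
vector does not change the law of the matrix. -/
lemma map_replaceComponent_matrix {κ ι : Type*} [Fintype κ] [Fintype ι] (w : ι → ℂ)
    (hw : star w ⬝ᵥ w = 1) :
    ((Measure.pi fun _ : κ => Measure.pi fun _ : ι => complexGaussian).prod
      (Measure.pi fun _ : κ => complexGaussian)).map
      (fun p => fun r i => p.1 r i + (p.2 r - p.1 r ⬝ᵥ w) * star (w i))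
      = Measure.pi fun _ : κ => Measure.pi fun _ : ι => complexGaussian := by
  have hmeas : Measurable fun p : (ι → ℂ) × ℂ =>
      fun i => p.1 i + (p.2 - p.1 ⬝ᵥ w) * star (w i) := by
    unfold dotProduct; fun_prop
  -- Matrix and fresh vector are regrouped into independent pairs (row, new entry), so the row
  -- statement applies to each pair.
  have h := measurePreserving_arrowProdEquivProdArrow (ι → ℂ) ℂ κ
    (fun _ => Measure.pi fun _ : ι => complexGaussian) (fun _ => complexGaussian)
  rw [← h.map_eq, Measure.map_map (by unfold dotProduct; fun_prop) h.measurable]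
  have h2 := Measure.pi_map_pi (μ := fun _ : κ =>
    (Measure.pi fun _ : ι => complexGaussian).prod complexGaussian)
    (f := fun _ p => fun i => p.1 i + (p.2 - p.1 ⬝ᵥ w) * star (w i))
    (fun _ => hmeas.aemeasurable)
  simp only [map_replaceComponent_row w hw] at h2
  exact h2

/-! ### Resampling a coordinate; the exponential tail of |z|² -/

/-- Resampling one coordinate of a product measure. -/
lemma map_update_pi {ι Y : Type*} [Fintype ι] [DecidableEq ι] {X : ι → Type*}
    [∀ i, MeasurableSpace (X i)] [MeasurableSpace Y] (μ : ∀ i, Measure (X i))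
    [∀ i, IsProbabilityMeasure (μ i)] (ν : Measure Y) [IsProbabilityMeasure ν] (i : ι)
    {e : X i × Y → X i} (he : Measurable e) (hmap : ((μ i).prod ν).map e = μ i) :
    ((Measure.pi μ).prod ν).map (fun p => Function.update p.1 i (e (p.1 i, p.2)))
      = Measure.pi μ := by
  have hm : Measurable fun p : (∀ i, X i) × Y => Function.update p.1 i (e (p.1 i, p.2)) := by
    fun_prop
  symm
  refine Measure.pi_eq fun s hs => ?_
  rw [Measure.map_apply hm (MeasurableSet.univ_pi hs),
    Measure.prod_apply_symm (hm (MeasurableSet.univ_pi hs))]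
  have h1 : ∀ y, Measure.pi μ ((fun x => (x, y)) ⁻¹'
      ((fun p : (∀ i, X i) × Y => Function.update p.1 i (e (p.1 i, p.2))) ⁻¹' Set.univ.pi s))
      -- For fixed `y`, the preimage of a box is a box in which only side `i` has changed.
      = (∏ j ∈ Finset.univ.erase i, μ j (s j)) * μ i ((fun x => (x, y)) ⁻¹' (e ⁻¹' s i)) := by
    intro y
    have : (fun x => (x, y)) ⁻¹'
        ((fun p : (∀ i, X i) × Y => Function.update p.1 i (e (p.1 i, p.2))) ⁻¹' Set.univ.pi s)
        = Set.univ.pi (Function.update s i ((fun x => (x, y)) ⁻¹' (e ⁻¹' s i))) := by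
      ext x
      simp only [Set.mem_preimage, Set.mem_univ_pi]
      refine forall_congr' fun j => ?_
      rcases eq_or_ne j i with rfl | hj
      · simp
      · simp [hj]
    rw [this, Measure.pi_pi, ← Finset.mul_prod_erase _ _ (Finset.mem_univ i), mul_comm]
    congr 1
    · refine Finset.prod_congr rfl fun j hj => ?_
      rw [Function.update_of_ne (Finset.ne_of_mem_erase hj)]
    · simp
  simp_rw [h1]
  rw [lintegral_const_mul _ (measurable_measure_prodMk_right (he (hs i))),
    ← Measure.prod_apply_symm (he (hs i)), ← Measure.map_apply he (hs i), hmap,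
    Finset.prod_erase_mul _ _ (Finset.mem_univ i)]

/-- A rotation-invariant density, which allows the tail to be computed in polar coordinates. -/
lemma complexGaussian_eq_withDensity :
    complexGaussian = (volume : Measure ℂ).withDensity
      (fun z => ENNReal.ofReal (Real.pi⁻¹ * Real.exp (-‖z‖ ^ 2))) := by
  have hv : ((1 : NNReal) / 2) ≠ 0 := by norm_num
  rw [complexGaussian, gaussianReal_of_var_ne_zero _ hv,
    prod_withDensity (by fun_prop) (by fun_prop)]
  ext s hs
  rw [Measure.map_apply (MeasurableEquiv.measurable _) hs,
    withDensity_apply _ (MeasurableEquiv.measurable _ hs), withDensity_apply _ hs,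
    ← (Complex.volume_preserving_equiv_real_prod.symm).setLIntegral_comp_preimage_emb
      Complex.measurableEquivRealProd.symm.measurableEmbedding]
  refine lintegral_congr fun p => ?_
  rw [gaussianPDF, gaussianPDF, ← ENNReal.ofReal_mul (gaussianPDFReal_nonneg _ _ _)]
  congr 1
  rw [gaussianPDFReal, gaussianPDFReal, Complex.sq_norm, Complex.normSq_apply]
  have h1 : (2 * Real.pi * ((1 / 2 : NNReal) : ℝ)) = Real.pi := by push_cast; ring
  have h2 : (√Real.pi)⁻¹ * (√Real.pi)⁻¹ = Real.pi⁻¹ := by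
    rw [← mul_inv, Real.mul_self_sqrt Real.pi_pos.le]
  rw [h1, mul_mul_mul_comm, h2, ← Real.exp_add]
  congr 2
  simp [Complex.measurableEquivRealProd]
  ring

/-- The squared modulus of a standard complex Gaussian is exponentially distributed. -/
lemma complexGaussian_tail {s : ℝ} (hs : 0 ≤ s) :
    complexGaussian {z | s ≤ ‖z‖ ^ 2} = ENNReal.ofReal (Real.exp (-s)) := by
  have hS : MeasurableSet {z : ℂ | s ≤ ‖z‖ ^ 2} := measurableSet_le (by fun_prop) (by fun_prop)
  rw [complexGaussian_eq_withDensity, withDensity_apply _ hS, ← lintegral_indicator hS,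
    ← Complex.lintegral_comp_polarCoord_symm, polarCoord_target,
    Measure.volume_eq_prod, ← Measure.prod_restrict]
  have hF : ∀ p : ℝ × ℝ, ENNReal.ofReal p.1 • ({z : ℂ | s ≤ ‖z‖ ^ 2}.indicator
      (fun z => ENNReal.ofReal (Real.pi⁻¹ * Real.exp (-‖z‖ ^ 2))) (Complex.polarCoord.symm p))
      = (fun r : ℝ => {r : ℝ | s ≤ r ^ 2}.indicator
        (fun r => ENNReal.ofReal (Real.pi⁻¹ * (r * Real.exp (-r ^ 2)))) r) p.1 * 1 := by
    intro p
    have hn : ‖Complex.polarCoord.symm p‖ ^ 2 = p.1 ^ 2 := by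
      rw [Complex.norm_polarCoord_symm, sq_abs]
    simp only [Set.indicator, Set.mem_ofPred_eq, hn]
    split_ifs
    · rw [smul_eq_mul, mul_one, ← ENNReal.ofReal_mul' (by positivity)]
      congr 1; ring
    · simp
  simp_rw [hF]
  have hS' : MeasurableSet {r : ℝ | s ≤ r ^ 2} := measurableSet_le (by fun_prop) (by fun_prop)
  rw [lintegral_prod_mul (g := fun _ : ℝ => 1)
    (Measurable.aemeasurable (Measurable.indicator (by fun_prop) hS')) (by fun_prop),
    lintegral_indicator hS', Measure.restrict_restrict hS']
  have hset : ({r : ℝ | s ≤ r ^ 2} ∩ Set.Ioi 0 : Set ℝ) =ᵐ[volume] (Set.Ioi (√s) : Set ℝ) := by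
    have h1 : {r : ℝ | s ≤ r ^ 2} ∩ Set.Ioi 0 = Set.Ici (√s) ∩ Set.Ioi 0 := by
      ext r
      simp only [Set.mem_inter_iff, Set.mem_ofPred_eq, Set.mem_Ioi, Set.mem_Ici]
      refine and_congr_left fun hr => ?_
      rw [Real.sqrt_le_left hr.le]
    have h2 : Set.Ioi (√s) = Set.Ioi (√s) ∩ Set.Ioi 0 :=
      (Set.inter_eq_left.2 (Set.Ioi_subset_Ioi (Real.sqrt_nonneg _))).symm
    rw [h1, h2]
    exact Ioi_ae_eq_Ici.symm.inter (ae_eq_refl _)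
  rw [Measure.restrict_congr_set hset]
  -- The factor `(2π)⁻¹` in the antiderivative cancels the length 2π of the angular interval.
  have hder : ∀ x ∈ Set.Ici (√s), HasDerivAt (fun r : ℝ => -(2 * Real.pi)⁻¹ * Real.exp (-r ^ 2))
      (Real.pi⁻¹ * (x * Real.exp (-x ^ 2))) x := by
    intro x _
    refine ((((hasDerivAt_pow 2 x).neg).exp).const_mul (-(2 * Real.pi)⁻¹)).congr_deriv ?_
    have := Real.pi_pos.ne'
    simp only [Pi.neg_apply, Nat.cast_ofNat, Nat.add_one_sub_one, pow_one]
    field_simp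
  have hnn : ∀ x ∈ Set.Ioi (√s), 0 ≤ Real.pi⁻¹ * (x * Real.exp (-x ^ 2)) := by
    intro x hx
    have : 0 ≤ x := (Real.sqrt_nonneg _).trans (le_of_lt hx)
    have := Real.pi_pos
    positivity
  have hlim : Tendsto (fun r : ℝ => -(2 * Real.pi)⁻¹ * Real.exp (-r ^ 2)) atTop (𝓝 0) := by
    rw [show (0 : ℝ) = -(2 * Real.pi)⁻¹ * 0 by simp]
    refine Tendsto.const_mul _ (Real.tendsto_exp_neg_atTop_nhds_zero.comp ?_)
    exact tendsto_pow_atTop two_ne_zero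
  have hint := integrableOn_Ioi_deriv_of_nonneg' hder hnn hlim
  rw [← ofReal_integral_eq_lintegral_ofReal hint
    ((ae_restrict_iff' measurableSet_Ioi).2 (ae_of_all _ hnn)),
    integral_Ioi_of_hasDerivAt_of_tendsto' hder hint hlim]
  rw [setLIntegral_one, Real.volume_Ioo,
    ← ENNReal.ofReal_mul' (by linarith [Real.pi_pos])]
  congr 1
  rw [Real.sq_sqrt hs]
  have := Real.pi_pos.ne'
  field_simp
  ring

/-! ### The law of the gain of a desired stream -/

namespace SymmetricSystem

variable {M : SymmetricSystem}

/-- The channels `H` with the direct link of user `k` replaced by `G`. -/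
def replaceDirect (H : M.Channel) (k : Fin M.N) (G : Fin M.Nr → Fin M.Nt → ℂ) : M.Channel :=
  Function.update H k (Function.update (H k) k G)

@[simp] lemma replaceDirect_self (H : M.Channel) (k : Fin M.N) (G : Fin M.Nr → Fin M.Nt → ℂ) :
    replaceDirect H k G k k = G := by
  simp [replaceDirect]

lemma replaceDirect_of_ne (H : M.Channel) (k : Fin M.N) (G : Fin M.Nr → Fin M.Nt → ℂ)
    {j i : Fin M.N} (h : j ≠ i) : replaceDirect H k G j i = H j i := by
  unfold replaceDirect
  rcases eq_or_ne j k with rfl | hj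
  · simp [h.symm]
  · simp [hj]

@[fun_prop]
lemma measurable_replaceDirect (k : Fin M.N) :
    Measurable fun p : M.Channel × (Fin M.Nr → Fin M.Nt → ℂ) => replaceDirect p.1 k p.2 := by
  unfold replaceDirect
  fun_prop

/-- Entry (k, k) is a coordinate inside coordinate k of a nested product, so the finite resampling
lemma is used twice. This isolates the direct link from everything the precoders see. -/
lemma lintegral_replaceDirect (k : Fin M.N) {F : M.Channel → ENNReal} (hF : Measurable F) :
    ∫⁻ H, F H ∂M.channelLaw = ∫⁻ H, ∫⁻ G, F (replaceDirect H k G)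
      ∂(Measure.pi fun _ : Fin M.Nr => Measure.pi fun _ : Fin M.Nt => complexGaussian)
      ∂M.channelLaw := by
  have h1 := map_update_pi (fun _ : Fin M.N => Measure.pi fun _ : Fin M.Nr =>
    Measure.pi fun _ : Fin M.Nt => complexGaussian)
    (Measure.pi fun _ : Fin M.Nr => Measure.pi fun _ : Fin M.Nt => complexGaussian) k
    (e := Prod.snd) measurable_snd (by rw [Measure.map_snd_prod]; simp)
  have h2 := map_update_pi (fun _ : Fin M.N => Measure.pi fun _ : Fin M.N =>
    Measure.pi fun _ : Fin M.Nr => Measure.pi fun _ : Fin M.Nt => complexGaussian)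
    (Measure.pi fun _ : Fin M.Nr => Measure.pi fun _ : Fin M.Nt => complexGaussian) k
    (e := fun p => Function.update p.1 k p.2) (by fun_prop) h1
  have h3 : (M.channelLaw.prod
      (Measure.pi fun _ : Fin M.Nr => Measure.pi fun _ : Fin M.Nt => complexGaussian)).map
      (fun p => replaceDirect p.1 k p.2) = M.channelLaw := h2
  conv_lhs => rw [← h3]
  rw [lintegral_map hF (by fun_prop), lintegral_prod _ (by fun_prop)]

lemma lintegral_replaceComponent {κ ι : Type*} [Fintype κ] [Fintype ι] (w : ι → ℂ)
    (hw : star w ⬝ᵥ w = 1) {F : (κ → ι → ℂ) → ENNReal} (hF : Measurable F) :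
    ∫⁻ G, F G ∂(Measure.pi fun _ : κ => Measure.pi fun _ : ι => complexGaussian)
      = ∫⁻ G, ∫⁻ z, F (fun r i => G r i + (z r - G r ⬝ᵥ w) * star (w i))
        ∂(Measure.pi fun _ : κ => complexGaussian)
        ∂(Measure.pi fun _ : κ => Measure.pi fun _ : ι => complexGaussian) := by
  have hm : Measurable fun p : (κ → ι → ℂ) × (κ → ℂ) =>
      fun r i => p.1 r i + (p.2 r - p.1 r ⬝ᵥ w) * star (w i) := by
    unfold dotProduct; fun_prop
  conv_lhs => rw [← map_replaceComponent_matrix w hw]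
  rw [lintegral_map hF hm]
  exact lintegral_prod _ (hF.comp hm).aemeasurable

namespace IAScheme

variable (S : M.IAScheme)

lemma measurable_gain (ℒ : Finset (Fin M.N)) (k i : Fin M.N) (m j : Fin M.d) :
    Measurable fun H => M.gain (S.u ℒ H k m) (H k i) (S.v ℒ H i j) := by
  have hu := S.measurable_u ℒ k m
  have hv := S.measurable_v ℒ i j
  unfold gain
  simp only [dotProduct, Matrix.mulVec, Pi.star_apply, Matrix.of_apply]
  fun_prop

/-- The gain of a desired stream is a standard complex Gaussian. -/
lemma map_gain_direct (ℒ : Finset (Fin M.N)) {k : Fin M.N} (hk : k ∈ ℒ) (m : Fin M.d) :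
    M.channelLaw.map (fun H => M.gain (S.u ℒ H k m) (H k k) (S.v ℒ H k m)) = complexGaussian := by
  have hf := S.measurable_gain ℒ k k m m
  ext B hB
  rw [Measure.map_apply hf hB, ← lintegral_indicator_one (hf hB)]
  have hF : Measurable (((fun H => M.gain (S.u ℒ H k m) (H k k) (S.v ℒ H k m)) ⁻¹' B).indicator
    (1 : M.Channel → ENNReal)) := measurable_one.indicator (hf hB)
  rw [lintegral_replaceDirect k hF]
  have key : ∀ H : M.Channel, ∫⁻ G,
      ((fun H => M.gain (S.u ℒ H k m) (H k k) (S.v ℒ H k m)) ⁻¹' B).indicator 1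
        (replaceDirect H k G)
      ∂(Measure.pi fun _ : Fin M.Nr => Measure.pi fun _ : Fin M.Nt => complexGaussian)
      = complexGaussian B := by
    intro H
    have hv : ∀ G j, S.v ℒ (replaceDirect H k G) k j = S.v ℒ H k j := fun G j =>
      S.v_congr ℒ _ _ (fun k' _ i' _ h => replaceDirect_of_ne H k G h) k hk j
    set w := S.v ℒ H k m with hw
    have hww : star w ⬝ᵥ w = 1 := by simpa using S.orthonormal_v ℒ H k hk m m
    have hFk : Measurable fun G : Fin M.Nr → Fin M.Nt → ℂ =>
        ((fun H => M.gain (S.u ℒ H k m) (H k k) (S.v ℒ H k m)) ⁻¹' B).indicator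
          (1 : M.Channel → ENNReal) (replaceDirect H k G) := hF.comp (by fun_prop)
    rw [lintegral_replaceComponent w hww hFk]
    -- The modified matrix sends `w` to `z` and agrees with `G` on vectors orthogonal to `w`.
    have hmul : ∀ (G : Fin M.Nr → Fin M.Nt → ℂ) (z : Fin M.Nr → ℂ) (x : Fin M.Nt → ℂ),
        (Matrix.of fun r i => G r i + (z r - G r ⬝ᵥ w) * star (w i)).mulVec x
          = fun r => G r ⬝ᵥ x + (z r - G r ⬝ᵥ w) * (star w ⬝ᵥ x) := by
      intro G z x
      ext r
      simp only [Matrix.mulVec, dotProduct, Matrix.of_apply, add_mul, Finset.sum_add_distrib,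
        Finset.mul_sum, Pi.star_apply, mul_assoc]
    have hgain : ∀ (G : Fin M.Nr → Fin M.Nt → ℂ) (z : Fin M.Nr → ℂ),
        M.gain (S.u ℒ (replaceDirect H k fun r i => G r i + (z r - G r ⬝ᵥ w) * star (w i)) k m)
          (replaceDirect H k (fun r i => G r i + (z r - G r ⬝ᵥ w) * star (w i)) k k)
          (S.v ℒ (replaceDirect H k fun r i => G r i + (z r - G r ⬝ᵥ w) * star (w i)) k m)
          = star (S.u ℒ (replaceDirect H k G) k m) ⬝ᵥ z := by
      intro G z
      have hu : S.u ℒ (replaceDirect H k fun r i => G r i + (z r - G r ⬝ᵥ w) * star (w i)) k m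
          = S.u ℒ (replaceDirect H k G) k m := by
        refine S.u_congr ℒ _ _ (fun k' _ i' _ h => ?_) k hk m fun j hj => ?_
        · rw [replaceDirect_of_ne _ _ _ h, replaceDirect_of_ne _ _ _ h]
        · rw [hv, replaceDirect_self, replaceDirect_self, hmul]
          -- Orthogonality of the streams: the directions that the combiner may use are not moved by
          -- the resampling.
          have : star w ⬝ᵥ S.v ℒ H k j = 0 := by
            rw [hw, S.orthonormal_v ℒ H k hk m j, if_neg hj.symm]
          simp only [this, mul_zero, add_zero]
          rfl
      rw [gain, hu, hv, replaceDirect_self, ← hw, hmul]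
      simp [hww]
    -- With `H` and `G` fixed, the combiner is a constant unit vector and `z` is a fresh Gaussian
    -- vector.
    have hinner : ∀ G : Fin M.Nr → Fin M.Nt → ℂ, ∫⁻ z,
        ((fun H => M.gain (S.u ℒ H k m) (H k k) (S.v ℒ H k m)) ⁻¹' B).indicator 1
          (replaceDirect H k fun r i => G r i + (z r - G r ⬝ᵥ w) * star (w i))
        ∂(Measure.pi fun _ : Fin M.Nr => complexGaussian) = complexGaussian B := by
      intro G
      have hmeas : Measurable fun z : Fin M.Nr → ℂ =>
          star (S.u ℒ (replaceDirect H k G) k m) ⬝ᵥ z := by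
        unfold dotProduct; fun_prop
      have hu1 := S.unit_u ℒ (replaceDirect H k G) k hk m
      have hB' := Measure.map_apply (μ := Measure.pi fun _ : Fin M.Nr => complexGaussian) hmeas hB
      rw [map_combination_pi_complexGaussian _ hu1, ← lintegral_indicator_one (hmeas hB)] at hB'
      rw [hB']
      refine lintegral_congr fun z => ?_
      by_cases hz : star (S.u ℒ (replaceDirect H k G) k m) ⬝ᵥ z ∈ B
      · rw [Set.indicator_of_mem, Set.indicator_of_mem]
        · rfl
        · exact hz
        · change M.gain _ _ _ ∈ B
          rw [hgain]; exact hz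
      · rw [Set.indicator_of_notMem, Set.indicator_of_notMem]
        · exact hz
        · change M.gain _ _ _ ∉ B
          rw [hgain]; exact hz
    simp_rw [hinner]
    simp
  simp_rw [key]
  simp

lemma measurable_sinr (ℒ : Finset (Fin M.N)) (k : Fin M.N) (m : Fin M.d) :
    Measurable fun H => S.sinr ℒ H k m := by
  unfold sinr
  refine Measurable.div ((((S.measurable_gain ℒ k k m m).norm).pow_const 2).const_mul _)
    (measurable_const.add (Finset.measurable_sum _ fun i _ => Finset.measurable_sum _ fun j _ => ?_))
  split_ifs
  · exact measurable_const
  · exact (((S.measurable_gain ℒ k i m j).norm).pow_const 2).const_mul _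

lemma α_pos (M : SymmetricSystem) : 0 < M.α :=
  div_pos (mul_pos M.P_pos M.ζ_pos) (Nat.cast_pos.2 M.d_pos)

/-- The success probability of a stream. -/
lemma channelLaw_success (ℒ : Finset (Fin M.N)) {k : Fin M.N} (hk : k ∈ ℒ) (m : Fin M.d) :
    M.channelLaw.real {H | M.τ ≤ S.sinr ℒ H k m} = Real.exp (-(M.σ ^ 2 * M.τ / M.α)) := by
  have hα := α_pos M
  have hσ := M.σ_pos
  have hs : 0 ≤ M.σ ^ 2 * M.τ / M.α := by
    have := M.τ_nonneg
    positivity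
  have hae : {H | M.τ ≤ S.sinr ℒ H k m} =ᵐ[M.channelLaw]
      (fun H => M.gain (S.u ℒ H k m) (H k k) (S.v ℒ H k m)) ⁻¹'
        {z | M.σ ^ 2 * M.τ / M.α ≤ ‖z‖ ^ 2} := by
    filter_upwards [S.aligned ℒ] with H hH
    have h0 : ∑ i ∈ ℒ, ∑ j : Fin M.d, (if (i, j) = (k, m) then 0
        else M.α * ‖M.gain (S.u ℒ H k m) (H k i) (S.v ℒ H i j)‖ ^ 2) = 0 := by
      refine Finset.sum_eq_zero fun i hi => Finset.sum_eq_zero fun j _ => ?_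
      split_ifs with h
      · rfl
      · rw [hH k hk i hi m j h]; simp
    have : (M.τ ≤ S.sinr ℒ H k m) = (M.σ ^ 2 * M.τ / M.α
        ≤ ‖M.gain (S.u ℒ H k m) (H k k) (S.v ℒ H k m)‖ ^ 2) := by
      rw [sinr, h0, add_zero, le_div_iff₀ (by positivity), div_le_iff₀ hα, mul_comm M.τ,
        mul_comm M.α]
    exact this
  rw [measureReal_congr hae, measureReal_def,
    ← Measure.map_apply (S.measurable_gain ℒ k k m m)
      (measurableSet_le (by fun_prop) (by fun_prop)),
    S.map_gain_direct ℒ hk m, complexGaussian_tail hs, ENNReal.toReal_ofReal (Real.exp_pos _).le]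

end IAScheme

/-! ### Mean service of an active set -/

/-- The expected service of user `k` when the set `ℒ` is active. -/
def meanRate (M : SymmetricSystem) (ℒ : Finset (Fin M.N)) (k : Fin M.N) : ℝ :=
  if k ∈ ℒ then M.μ ℒ.card else 0

namespace IAScheme

variable (S : M.IAScheme)

lemma measurable_service (ℒ : Finset (Fin M.N)) (k : Fin M.N) :
    Measurable fun H => S.service ℒ H k := by
  unfold service
  split_ifs
  · refine (Finset.measurable_sum _ fun m _ => ?_).const_mul _
    exact Measurable.ite (measurableSet_le measurable_const (S.measurable_sinr ℒ k m))
      measurable_const measurable_const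
  · exact measurable_const

lemma card_mul_θ_le (ℒ : Finset (Fin M.N)) : ℒ.card * M.θ ≤ 1 := by
  have h1 : (ℒ.card : ℝ) ≤ M.N := by
    exact_mod_cast (Finset.card_le_univ ℒ).trans_eq (Fintype.card_fin _)
  exact (mul_le_mul_of_nonneg_right h1 M.θ_pos.le).trans M.Nθ_lt_one.le

lemma service_nonneg (ℒ : Finset (Fin M.N)) (H : M.Channel) (k : Fin M.N) :
    0 ≤ S.service ℒ H k := by
  unfold service
  split_ifs
  · refine mul_nonneg (by linarith [card_mul_θ_le ℒ]) (Finset.sum_nonneg fun m _ => ?_)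
    split_ifs
    exacts [M.R_pos.le, le_rfl]
  · exact le_rfl

lemma service_le (ℒ : Finset (Fin M.N)) (H : M.Channel) (k : Fin M.N) :
    S.service ℒ H k ≤ M.d * M.R := by
  have hd : (0 : ℝ) ≤ M.d * M.R := mul_nonneg (Nat.cast_nonneg _) M.R_pos.le
  unfold service
  split_ifs
  · have h1 : ∑ m : Fin M.d, (if M.τ ≤ S.sinr ℒ H k m then M.R else 0) ≤ M.d * M.R := by
      refine (Finset.sum_le_card_nsmul _ _ M.R fun m _ => ?_).trans_eq (by simp)
      split_ifs
      exacts [le_rfl, M.R_pos.le]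
    have h2 : 0 ≤ ℒ.card * M.θ := mul_nonneg (Nat.cast_nonneg _) M.θ_pos.le
    calc _ ≤ (1 - ℒ.card * M.θ) * (M.d * M.R) :=
          mul_le_mul_of_nonneg_left h1 (by linarith [card_mul_θ_le ℒ])
      _ ≤ 1 * (M.d * M.R) := mul_le_mul_of_nonneg_right (by linarith) hd
      _ = _ := one_mul _
  · exact hd

/-- Linearity over the streams suffices: the streams of a user need not be independent. -/
lemma integral_service (ℒ : Finset (Fin M.N)) (k : Fin M.N) :
    ∫ H, S.service ℒ H k ∂M.channelLaw = M.meanRate ℒ k := by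
  classical
  by_cases hk : k ∈ ℒ
  · simp only [service, meanRate, if_pos hk]
    rw [integral_const_mul, integral_finsetSum]
    · have h : ∀ m : Fin M.d, ∫ H, (if M.τ ≤ S.sinr ℒ H k m then M.R else 0) ∂M.channelLaw
          = Real.exp (-(M.σ ^ 2 * M.τ / M.α)) * M.R := by
        intro m
        have hms : MeasurableSet {H | M.τ ≤ S.sinr ℒ H k m} :=
          measurableSet_le measurable_const (S.measurable_sinr ℒ k m)
        have := integral_indicator_const (μ := M.channelLaw) M.R hms
        rw [S.channelLaw_success ℒ hk m] at this
        exact this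
      simp_rw [h]
      simp only [μ, Finset.sum_const, Finset.card_univ, Fintype.card_fin, nsmul_eq_mul]
      ring
    · intro m _
      refine Integrable.of_bound (C := M.R) (Measurable.aestronglyMeasurable <|
        Measurable.ite (measurableSet_le measurable_const (S.measurable_sinr ℒ k m))
          measurable_const measurable_const) (ae_of_all _ fun H => ?_)
      split_ifs <;> simp [abs_of_pos M.R_pos, M.R_pos.le]
  · simp [service, meanRate, hk]

end IAScheme

end SymmetricSystem

/-! ### Geometry of Λ_P -/

/-- The uniform distribution on a set is a mixture of uniform distributions on smaller sets. -/
lemma normalized_indicator_mem_of_convex {ι : Type*} [DecidableEq ι] {C : Set (ι → ℝ)}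
    (hC : Convex ℝ C) (c : ℝ) {l : ℕ} (hl : 0 < l)
    (h : ∀ t : Finset ι, t.card = l → (c / t.card) • (fun k => if k ∈ t then (1 : ℝ) else 0) ∈ C) :
    ∀ t : Finset ι, l ≤ t.card → (c / t.card) • (fun k => if k ∈ t then (1 : ℝ) else 0) ∈ C := by
  intro t ht
  obtain ⟨n, hn⟩ := Nat.exists_eq_add_of_le ht
  induction n generalizing t with
  | zero => exact h t hn
  | succ n ih =>
    have hcard : ∀ k ∈ t, (t.erase k).card = l + n := fun k hk => by
      rw [Finset.card_erase_of_mem hk, hn]; rfl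
    -- Average over the element that is left out. Each `j ∈ t` survives in `|t| - 1` of the sets,
    -- which turns `c / (|t| - 1)` into `c / |t|`.
    have hmem : ∑ k ∈ t, (1 / (t.card : ℝ)) •
        ((c / (t.erase k).card) • (fun j => if j ∈ t.erase k then (1 : ℝ) else 0)) ∈ C := by
      refine hC.sum_mem (fun _ _ => by positivity) ?_
        fun k hk => ih _ ((hcard k hk).symm ▸ Nat.le_add_right _ _) (hcard k hk)
      rw [Finset.sum_const, nsmul_eq_mul]
      have : (t.card : ℝ) ≠ 0 := by rw [hn]; positivity
      field_simp
    convert hmem using 1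
    ext j
    rw [Finset.sum_apply]
    have : ∀ k ∈ t, ((1 / (t.card : ℝ)) • ((c / (t.erase k).card) •
        (fun j => if j ∈ t.erase k then (1 : ℝ) else 0))) j
        = (1 / (t.card : ℝ)) * (c / (l + n)) * ((if j ∈ t then 1 else 0)
          - if k = j then (if j ∈ t then 1 else 0) else 0) := by
      intro k hk
      simp only [Pi.smul_apply, smul_eq_mul, hcard k hk, Finset.mem_erase]
      push_cast
      by_cases hj : j ∈ t <;> by_cases hjk : k = j <;> simp [hj, hjk, eq_comm]
      all_goals simp_all [eq_comm]
    rw [Finset.sum_congr rfl this, ← Finset.mul_sum, Finset.sum_sub_distrib, Finset.sum_const,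
      Finset.sum_ite_eq' t j, nsmul_eq_mul]
    by_cases hj : j ∈ t
    · simp only [Pi.smul_apply, hj, if_true, smul_eq_mul, hn]
      push_cast
      field_simp
      ring
    · simp [hj]

namespace SymmetricSystem

variable (M : SymmetricSystem)

lemma convex_regionP : Convex ℝ M.regionP := convex_closedConvexHull
lemma isClosed_regionP : IsClosed M.regionP := isClosed_closedConvexHull

lemma meanRate_eq_smul (ℒ : Finset (Fin M.N)) :
    M.meanRate ℒ = M.μ ℒ.card • fun k => if k ∈ ℒ then (1 : ℝ) else 0 := by
  ext k; simp [meanRate]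

lemma meanRate_mem_rateVectors (ℒ : Finset (Fin M.N)) :
    M.meanRate ℒ ∈ M.rateVectors ℒ.card := by
  refine ⟨fun k => if k ∈ ℒ then (1 : ℝ) else 0, ⟨fun k => ?_, ?_⟩, (M.meanRate_eq_smul ℒ).symm⟩
  · dsimp only; split_ifs <;> simp
  · simp [apply_ite abs]

lemma exists_meanRate_of_mem_rateVectors {L : ℕ} {x : Fin M.N → ℝ} (hx : x ∈ M.rateVectors L) :
    ∃ ℒ, x = M.meanRate ℒ := by
  classical
  obtain ⟨s, ⟨hs, hsum⟩, rfl⟩ := hx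
  have h1 : s = fun k => if k ∈ Finset.univ.filter (fun k => s k = 1) then (1 : ℝ) else 0 := by
    ext k
    rcases hs k with h | h <;> simp [h]
  refine ⟨Finset.univ.filter fun k => s k = 1, ?_⟩
  have h2 : (Finset.univ.filter fun k => s k = 1).card = L := by
    rw [h1] at hsum
    simp only [apply_ite abs, abs_one, abs_zero, Finset.sum_ite_mem, Finset.univ_inter,
      Finset.sum_const, nsmul_eq_mul, mul_one] at hsum
    exact_mod_cast hsum
  rw [meanRate_eq_smul, h2, ← h1]

lemma regionP_subset {C : Set (Fin M.N → ℝ)} (hC : Convex ℝ C) (hC' : IsClosed C)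
    (h : ∀ ℒ, M.meanRate ℒ ∈ C) : M.regionP ⊆ C := by
  refine closedConvexHull_min (Set.iUnion₂_subset fun L _ x hx => ?_) hC hC'
  obtain ⟨ℒ, rfl⟩ := M.exists_meanRate_of_mem_rateVectors hx
  exact h ℒ

lemma μ_eq (L : ℕ) :
    M.μ L = (1 - L * M.θ) * (M.d * M.R * Real.exp (-(M.σ ^ 2 * M.τ / M.α))) := by
  rw [μ]; ring

lemma fullRate_pos : 0 < M.d * M.R * Real.exp (-(M.σ ^ 2 * M.τ / M.α)) :=
  mul_pos (mul_pos (Nat.cast_pos.2 M.d_pos) M.R_pos) (Real.exp_pos _)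

lemma μ_pos {L : ℕ} (hL : L ≤ M.N) : 0 < M.μ L := by
  rw [μ_eq]
  refine mul_pos ?_ M.fullRate_pos
  have : (L : ℝ) * M.θ ≤ M.N * M.θ :=
    mul_le_mul_of_nonneg_right (Nat.cast_le.2 hL) M.θ_pos.le
  linarith [M.Nθ_lt_one]

lemma μ_anti {L L' : ℕ} (h : L ≤ L') : M.μ L' ≤ M.μ L := by
  rw [μ_eq, μ_eq]
  refine mul_le_mul_of_nonneg_right ?_ M.fullRate_pos.le
  have : (L : ℝ) * M.θ ≤ L' * M.θ :=
    mul_le_mul_of_nonneg_right (Nat.cast_le.2 h) M.θ_pos.le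
  linarith

/-- The factor `1 - (L + L')θ` expresses the symmetry of the parabola about 1/(2θ): its sign is
known as soon as both arguments lie on the same side of the peak. -/
lemma μT_sub (L L' : ℕ) : M.μT L - M.μT L' = ((L : ℝ) - L') * (1 - (L + L') * M.θ)
    * (M.d * M.R * Real.exp (-(M.σ ^ 2 * M.τ / M.α))) := by
  rw [μT, μT, μ_eq, μ_eq]; ring

/-- `L_P` maximizes the total rate. -/
lemma μT_le_μT_LP (L : ℕ) : M.μT L ≤ M.μT M.LP := by
  have hθ := M.θ_pos
  have hx : 0 ≤ 1 / (2 * M.θ) := by positivity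
  have hxθ : 1 / (2 * M.θ) * M.θ = 1 / 2 := by field_simp
  have hmax : M.μT ⌊1 / (2 * M.θ)⌋₊ ≤ M.μT M.LP ∧ M.μT ⌈1 / (2 * M.θ)⌉₊ ≤ M.μT M.LP := by
    unfold LP
    split_ifs with h
    · exact ⟨h, le_rfl⟩
    · exact ⟨le_rfl, (not_le.1 h).le⟩
  rcases le_or_gt L ⌊1 / (2 * M.θ)⌋₊ with h | h
  · refine le_trans ?_ hmax.1
    rw [← sub_nonneg, μT_sub]
    have h1 : (L : ℝ) ≤ ⌊1 / (2 * M.θ)⌋₊ := Nat.cast_le.2 h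
    have h2 := Nat.floor_le hx
    refine mul_nonneg (mul_nonneg (by linarith) ?_) M.fullRate_pos.le
    have := mul_le_mul_of_nonneg_right (add_le_add h2 (h1.trans h2)) hθ.le
    rw [add_mul, add_mul, hxθ] at this
    linarith
  · refine le_trans ?_ hmax.2
    -- An integer above the floor is at least the ceiling, so no integer lies strictly between the
    -- two cases.
    have h0 : ⌈1 / (2 * M.θ)⌉₊ ≤ L := (Nat.ceil_le_floor_add_one _).trans h
    rw [← sub_nonneg, μT_sub]
    have h1 : ((⌈1 / (2 * M.θ)⌉₊ : ℕ) : ℝ) ≤ L := Nat.cast_le.2 h0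
    have h2 := Nat.le_ceil (1 / (2 * M.θ))
    refine mul_nonneg (mul_nonneg_of_nonpos_of_nonpos (by linarith) ?_) M.fullRate_pos.le
    have := mul_le_mul_of_nonneg_right (add_le_add h2 (h2.trans h1)) hθ.le
    rw [add_mul, add_mul, hxθ] at this
    linarith

lemma meanRate_mem_regionP_of_card_le {ℒ : Finset (Fin M.N)} (h : ℒ.card ≤ M.LP) :
    M.meanRate ℒ ∈ M.regionP :=
  subset_closedConvexHull (Set.mem_iUnion₂.2 ⟨_, h, M.meanRate_mem_rateVectors ℒ⟩)

lemma zero_mem_regionP : (0 : Fin M.N → ℝ) ∈ M.regionP := by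
  have := M.meanRate_mem_regionP_of_card_le (ℒ := ∅) (by simp)
  rwa [show M.meanRate ∅ = 0 by ext; simp [meanRate]] at this

/-- The mean service vector of every active set is in `Λ_P`. -/
lemma meanRate_mem_regionP (ℒ : Finset (Fin M.N)) : M.meanRate ℒ ∈ M.regionP := by
  rcases le_or_gt ℒ.card M.LP with h | h
  · exact M.meanRate_mem_regionP_of_card_le h
  have hN : ℒ.card ≤ M.N := (Finset.card_le_univ ℒ).trans_eq (Fintype.card_fin _)
  have hL0 : (0 : ℝ) < ℒ.card := Nat.cast_pos.2 (by omega)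
  have hTpos : 0 < M.μT ℒ.card := mul_pos hL0 (M.μ_pos hN)
  have hle := M.μT_le_μT_LP ℒ.card
  -- If L_P were 0, the maximal total rate would be 0, against the positive total rate of `ℒ`.
  have hLP : 0 < M.LP := by
    by_contra h0
    have : M.LP = 0 := by omega
    rw [this] at hle
    simp [μT] at hle hTpos
    linarith
  -- The total μ_T(L_P) split equally over `ℒ` is in Λ_P. Shrinking towards 0 by the factor
  -- μ_T(|ℒ|)/μ_T(L_P) ≤ 1 then gives the actual rate vector.
  have key := normalized_indicator_mem_of_convex M.convex_regionP (M.μT M.LP) hLP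
    (fun t ht => by
      have h1 := M.meanRate_mem_regionP_of_card_le (ℒ := t) ht.le
      rw [meanRate_eq_smul] at h1
      have h2 : (M.LP : ℝ) ≠ 0 := Nat.cast_ne_zero.2 hLP.ne'
      rwa [ht, μT, mul_div_cancel_left₀ _ h2, ← ht]) ℒ h.le
  have h3 := M.convex_regionP.smul_mem_of_zero_mem M.zero_mem_regionP key
    (t := M.μT ℒ.card / M.μT M.LP)
    ⟨div_nonneg hTpos.le (hTpos.le.trans hle), div_le_one_of_le₀ hle (hTpos.le.trans hle)⟩
  rw [smul_smul] at h3
  rw [meanRate_eq_smul]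
  convert h3 using 2
  have : M.μT M.LP ≠ 0 := (hTpos.trans_le hle).ne'
  rw [div_mul_div_comm, mul_comm (M.μT M.LP), mul_div_mul_right _ _ this, μT,
    mul_div_cancel_left₀ _ hL0.ne']

lemma nonneg_of_mem_regionP {x : Fin M.N → ℝ} (hx : x ∈ M.regionP) (k : Fin M.N) : 0 ≤ x k := by
  have : M.regionP ⊆ {x | 0 ≤ x k} := by
    refine M.regionP_subset (convex_halfSpace_ge (LinearMap.proj (R := ℝ) k).isLinear 0)
      (isClosed_le continuous_const (continuous_apply k)) fun ℒ => ?_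
    change 0 ≤ M.meanRate ℒ k
    unfold meanRate
    split_ifs
    · exact (M.μ_pos ((Finset.card_le_univ ℒ).trans_eq (Fintype.card_fin _))).le
    · exact le_rfl
  exact this hx

/-- It suffices to check the generators. Switching user `k` off leaves the others at least the rate
they had, because μ decreases, so the updated vector is a shrunken copy of the rate vector of
`ℒ.erase k`. -/
lemma update_zero_mem_regionP {x : Fin M.N → ℝ} (hx : x ∈ M.regionP) (k : Fin M.N) :
    Function.update x k 0 ∈ M.regionP := by
  classical
  have hadd : ∀ (x y : Fin M.N → ℝ) (s t : ℝ), Function.update (s • x + t • y) k 0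
      = s • Function.update x k 0 + t • Function.update y k 0 := by
    intro x y s t
    ext j
    rcases eq_or_ne j k with rfl | hj
    · simp
    · simp [hj]
  have : M.regionP ⊆ {x : Fin M.N → ℝ | Function.update x k 0 ∈ M.regionP} := by
    refine M.regionP_subset ?_ (M.isClosed_regionP.preimage (by fun_prop)) fun ℒ => ?_
    · intro x hx y hy s t hs ht hst
      change Function.update (s • x + t • y) k 0 ∈ M.regionP
      rw [hadd]
      exact M.convex_regionP hx hy hs ht hst
    · change Function.update (M.meanRate ℒ) k 0 ∈ M.regionP
      by_cases hk : k ∈ ℒ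
      · have hN : ℒ.card ≤ M.N := (Finset.card_le_univ ℒ).trans_eq (Fintype.card_fin _)
        have hc : (ℒ.erase k).card ≤ ℒ.card := Finset.card_le_card (Finset.erase_subset _ _)
        have hp := M.μ_pos (hc.trans hN)
        have := M.convex_regionP.smul_mem_of_zero_mem M.zero_mem_regionP
          (M.meanRate_mem_regionP (ℒ.erase k)) (t := M.μ ℒ.card / M.μ (ℒ.erase k).card)
          ⟨div_nonneg (M.μ_pos hN).le hp.le, div_le_one_of_le₀ (M.μ_anti hc) hp.le⟩
        convert this using 1
        ext j
        rcases eq_or_ne j k with rfl | hj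
        · simp [meanRate]
        · by_cases hjL : j ∈ ℒ <;> simp [meanRate, hj, hjL, hp.ne']
      · rw [Function.update_eq_self_iff.2]
        · exact M.meanRate_mem_regionP ℒ
        · simp [meanRate, hk]
  exact this hx

/-- `Λ_P` is a lower set of the nonnegative orthant. -/
lemma mem_regionP_of_le {x y : Fin M.N → ℝ} (hx : x ∈ M.regionP) (hy : ∀ k, 0 ≤ y k)
    (hyx : ∀ k, y k ≤ x k) : y ∈ M.regionP := by
  classical
  have key : ∀ s : Finset (Fin M.N), s.piecewise y x ∈ M.regionP := by
    intro s
    induction s using Finset.induction_on with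
    | empty => simpa using hx
    | insert k s hk ih =>
      rw [Finset.piecewise_insert]
      set z := s.piecewise y x with hz
      have hzk : z k = x k := by simp [hz, hk]
      rcases (M.nonneg_of_mem_regionP hx k).eq_or_lt with h0 | h0
      · rwa [Function.update_eq_self_iff.2]
        rw [hzk]; exact le_antisymm (hyx k) (h0 ▸ hy k)
      -- Coordinate `k` is lowered from `x k` to `y k` by interpolating between `z` and `z` with
      -- that coordinate set to 0.
      · have := M.convex_regionP ih (M.update_zero_mem_regionP ih k)
          (a := y k / x k) (b := 1 - y k / x k) (div_nonneg (hy k) h0.le)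
          (by linarith [div_le_one_of_le₀ (hyx k) h0.le]) (by ring)
        convert this using 1
        ext j
        rcases eq_or_ne j k with rfl | hj
        · simp [hzk, h0.ne']
        · simp [hj]
          ring
  simpa using key Finset.univ

/-- Mixing into `a` the rate vector of the full active set, which is positive in every coordinate,
gives a point of Λ_P strictly above `(1 - δ) a`. The lower-set property then fills a neighbourhood
in the orthant. -/
lemma regionP_mem_nhdsWithin_smul {a : Fin M.N → ℝ} (ha : a ∈ M.regionP) {δ : ℝ} (hδ : 0 < δ)
    (hδ1 : δ ≤ 1) : M.regionP ∈ 𝓝[{b | ∀ k, 0 ≤ b k}] ((1 - δ) • a) := by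
  have hx : (1 - δ) • a + δ • M.meanRate Finset.univ ∈ M.regionP :=
    M.convex_regionP ha (M.meanRate_mem_regionP _) (by linarith) hδ.le (by ring)
  have hU : IsOpen {b : Fin M.N → ℝ | ∀ k, b k < ((1 - δ) • a + δ • M.meanRate Finset.univ) k} := by
    simp only [Set.ofPred_forall]
    exact isOpen_iInter_of_finite fun k => isOpen_lt (continuous_apply k) continuous_const
  refine mem_nhdsWithin.2 ⟨_, hU, fun k => ?_, fun b hb => ?_⟩
  · have : 0 < M.meanRate Finset.univ k := by
      simp only [meanRate, Finset.mem_univ, if_true]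
      exact M.μ_pos (by simp)
    simp only [Pi.add_apply, Pi.smul_apply, smul_eq_mul]
    linarith [mul_pos hδ this]
  · exact M.mem_regionP_of_le hx hb.2 fun k => (hb.1 k).le

lemma exists_add_mem_regionP {a : Fin M.N → ℝ} (ha : ∀ k, 0 ≤ a k)
    (h : M.regionP ∈ 𝓝[{b | ∀ k, 0 ≤ b k}] a) :
    ∃ ε > 0, (fun k => a k + ε) ∈ M.regionP := by
  have ht : Tendsto (fun ε : ℝ => fun k => a k + ε) (𝓝[>] 0) (𝓝[{b | ∀ k, 0 ≤ b k}] a) := by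
    refine tendsto_nhdsWithin_iff.2 ⟨?_, ?_⟩
    · have : Continuous fun ε : ℝ => fun k => a k + ε := by fun_prop
      have := this.tendsto 0
      simp only [add_zero] at this
      exact this.mono_left nhdsWithin_le_nhds
    · filter_upwards [self_mem_nhdsWithin] with ε hε k
      exact add_nonneg (ha k) (le_of_lt hε)
  obtain ⟨ε, hε, hε0⟩ := ((ht.eventually h).and self_mem_nhdsWithin).exists
  exact ⟨ε, hε0, hε⟩

end SymmetricSystem

/-! ### Independence of a slot from the past -/

/-- Resampling one coordinate of an infinite product measure. -/
lemma map_update_infinitePi {X : Type*} [MeasurableSpace X] (μ : Measure X)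
    [IsProbabilityMeasure μ] (t : ℕ) :
    ((Measure.infinitePi fun _ : ℕ => μ).prod μ).map (fun p => Function.update p.1 t p.2)
      = Measure.infinitePi fun _ : ℕ => μ := by
  classical
  refine Measure.eq_infinitePi _ fun s B hB => ?_
  have hpre : (fun p : (ℕ → X) × X => Function.update p.1 t p.2) ⁻¹' Set.pi s B
      = Set.pi (s.erase t) B ×ˢ (if t ∈ s then B t else Set.univ) := by
    ext ⟨ω, x⟩
    simp only [Set.mem_preimage, Set.mem_pi, Finset.mem_coe, Set.mem_prod, Finset.mem_erase]
    constructor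
    · intro h
      refine ⟨fun i hi => by simpa [hi.1] using h i hi.2, ?_⟩
      split_ifs with ht
      · simpa using h t ht
      · trivial
    · rintro ⟨h1, h2⟩ i hi
      rcases eq_or_ne i t with rfl | hit
      · simpa [hi] using h2
      · simpa [hit] using h1 i ⟨hit, hi⟩
  rw [Measure.map_apply (by fun_prop) (MeasurableSet.pi s.countable_toSet fun i _ => hB i), hpre,
    Measure.prod_prod, Measure.infinitePi_pi _ fun i _ => hB i]
  split_ifs with ht
  · rw [Finset.prod_erase_mul _ (fun i => μ (B i)) ht]
  · rw [Finset.erase_eq_of_notMem ht]; simp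

lemma integrable_of_ae_abs_le {Ω : Type*} [MeasurableSpace Ω] {P : Measure Ω}
    [IsProbabilityMeasure P] {f : Ω → ℝ} (hf : Measurable f) {C : ℝ} (h : ∀ᵐ ω ∂P, |f ω| ≤ C) :
    Integrable f P :=
  Integrable.of_bound hf.aestronglyMeasurable C h

lemma ArrivalLaw.mean_nonneg {N : ℕ} (A : ArrivalLaw N) (k : Fin N) : 0 ≤ A.mean k := by
  obtain ⟨C, hC⟩ := A.bounded
  exact integral_nonneg_of_ae ((hC k).mono fun x hx => hx.1)

namespace SymmetricSystem

variable {M : SymmetricSystem}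

instance (A : ArrivalLaw M.N) : IsProbabilityMeasure (pathLaw A) := by
  unfold pathLaw; infer_instance

/-- Arrivals are almost surely bounded and nonnegative in all slots. -/
lemma ae_arrival_bounded (A : ArrivalLaw M.N) :
    ∃ C : ℝ, 0 ≤ C ∧ ∀ᵐ ω ∂pathLaw A, ∀ t k, 0 ≤ (ω t).1 k ∧ (ω t).1 k ≤ C := by
  obtain ⟨C, hC⟩ := A.bounded
  refine ⟨max C 0, le_max_right _ _, ae_all_iff.2 fun t => ae_all_iff.2 fun k => ?_⟩
  have h1 : MeasurePreserving (fun ω : ℕ → M.Slot => ω t) (pathLaw A) (slotLaw A) :=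
    measurePreserving_eval_infinitePi (fun _ => slotLaw A) t
  have h2 : MeasurePreserving (Prod.fst : M.Slot → _) (slotLaw A) (Measure.pi A.law) :=
    measurePreserving_fst
  have h3 := measurePreserving_eval A.law k
  have h := (h3.comp (h2.comp h1)).quasiMeasurePreserving.ae (hC k)
  filter_upwards [h] with ω hω
  exact ⟨hω.1, hω.2.le.trans (le_max_left _ _)⟩

lemma integral_arrival (A : ArrivalLaw M.N) (k : Fin M.N) :
    ∫ x, x.1 k ∂slotLaw A = A.mean k := by
  have h2 : MeasurePreserving (Prod.fst : M.Slot → _) (slotLaw A) (Measure.pi A.law) :=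
    measurePreserving_fst
  have h := (measurePreserving_eval A.law k).comp h2
  rw [ArrivalLaw.mean, ← h.map_eq, integral_map h.measurable.aemeasurable (by fun_prop)]
  rfl

namespace IAScheme

variable (S : M.IAScheme)

lemma measurable_service_prod (k : Fin M.N) :
    Measurable fun p : Finset (Fin M.N) × M.Channel => S.service p.1 p.2 k :=
  measurable_from_prod_countable_right fun ℒ => S.measurable_service ℒ k

/-- The seed is independent of the channels, so the channels can be averaged first with the active
set frozen. -/
lemma integral_service_select (A : ArrivalLaw M.N) (k : Fin M.N)
    {f : unitInterval → Finset (Fin M.N)} (hf : Measurable f) :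
    ∫ x, S.service (f x.2.2) x.2.1 k ∂slotLaw A = ∫ x, M.meanRate (f x.2.2) k ∂slotLaw A := by
  have hm : Measurable fun y : M.Channel × unitInterval => S.service (f y.2) y.1 k :=
    (S.measurable_service_prod k).comp
      ((hf.comp measurable_snd).prodMk measurable_fst)
  have hint : Integrable (fun y : M.Channel × unitInterval => S.service (f y.2) y.1 k)
      (M.channelLaw.prod volume) :=
    integrable_of_ae_abs_le hm (C := M.d * M.R) (ae_of_all _ fun y => by
      rw [abs_of_nonneg (S.service_nonneg _ _ _)]; exact S.service_le _ _ _)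
  have h1 := integral_fun_snd (μ := Measure.pi A.law) (ν := M.channelLaw.prod volume)
    (fun y : M.Channel × unitInterval => S.service (f y.2) y.1 k)
  have h2 := integral_fun_snd (μ := Measure.pi A.law) (ν := M.channelLaw.prod volume)
    (fun y : M.Channel × unitInterval => M.meanRate (f y.2) k)
  have h3 := integral_fun_snd (μ := M.channelLaw) (ν := (volume : Measure unitInterval))
    (fun s => M.meanRate (f s) k)
  rw [slotLaw, h1, h2, h3, integral_prod_symm _ hint]
  simp_rw [S.integral_service]
  simp

variable (π : Policy M.N) (q₀ : Fin M.N → ℝ)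

/-- The active set of slot `t`. -/
def active (ω : ℕ → M.Slot) (t : ℕ) : Finset (Fin M.N) :=
  π.select t (S.history π q₀ ω t) (ω t).2.2

lemma queue_zero (ω : ℕ → M.Slot) : S.queue π q₀ ω 0 = q₀ := rfl

lemma queue_succ (ω : ℕ → M.Slot) (t : ℕ) (k : Fin M.N) :
    S.queue π q₀ ω (t + 1) k = max (S.queue π q₀ ω t k
      - S.service (S.active π q₀ ω t) (ω t).2.1 k) 0 + (ω t).1 k := by
  simp [queue, history, active]

lemma history_congr {ω ω' : ℕ → M.Slot} {t : ℕ} (h : ∀ i < t, ω i = ω' i) :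
    S.history π q₀ ω t = S.history π q₀ ω' t := by
  induction t with
  | zero => rfl
  | succ t ih =>
    simp only [history, ih fun i hi => h i (hi.trans t.lt_succ_self), h t t.lt_succ_self]

lemma history_update (ω : ℕ → M.Slot) (t : ℕ) (x : M.Slot) :
    S.history π q₀ (Function.update ω t x) t = S.history π q₀ ω t :=
  S.history_congr π q₀ fun _ hi => Function.update_of_ne hi.ne _ _

lemma measurable_history (t : ℕ) : Measurable fun ω => S.history π q₀ ω t := by
  induction t with
  | zero => exact measurable_const
  | succ t ih =>
    refine measurable_pi_iff.2 fun i => ?_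
    induction i using Fin.lastCases with
    | cast i =>
      simp only [history, Fin.snoc_castSucc]
      exact (measurable_pi_apply i).comp ih
    | last =>
      simp only [history, Fin.snoc_last]
      refine measurable_pi_iff.2 fun k => ?_
      have hsel : Measurable fun ω : ℕ → M.Slot =>
          π.select t (S.history π q₀ ω t) (ω t).2.2 :=
        (π.measurable_select t).comp (ih.prodMk (by fun_prop))
      have hser : Measurable fun ω : ℕ → M.Slot =>
          S.service (π.select t (S.history π q₀ ω t) (ω t).2.2) (ω t).2.1 k :=
        (S.measurable_service_prod k).comp (hsel.prodMk (by fun_prop))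
      have hq : Measurable fun ω : ℕ → M.Slot => S.history π q₀ ω t (Fin.last t) k := by
        fun_prop
      exact ((hq.sub hser).max measurable_const).add (by fun_prop)

lemma measurable_queue (t : ℕ) (k : Fin M.N) : Measurable fun ω => S.queue π q₀ ω t k := by
  have := S.measurable_history π q₀ t
  unfold queue
  fun_prop

lemma measurable_active (t : ℕ) : Measurable fun ω => S.active π q₀ ω t :=
  (π.measurable_select t).comp ((S.measurable_history π q₀ t).prodMk (by fun_prop))

lemma measurable_meanRate_active (t : ℕ) (k : Fin M.N) :
    Measurable fun ω => M.meanRate (S.active π q₀ ω t) k :=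
  (measurable_of_countable fun ℒ => M.meanRate ℒ k).comp (S.measurable_active π q₀ t)

lemma measurable_service_active (t : ℕ) (k : Fin M.N) :
    Measurable fun ω : ℕ → M.Slot => S.service (S.active π q₀ ω t) (ω t).2.1 k :=
  (S.measurable_service_prod k).comp ((S.measurable_active π q₀ t).prodMk (by fun_prop))

/-- The slot at time `t` is independent of the history up to time `t`. -/
lemma integral_history_slot (A : ArrivalLaw M.N) (t : ℕ)
    {F : (Fin (t + 1) → Fin M.N → ℝ) × M.Slot → ℝ} (hF : Measurable F)
    (hint : Integrable (fun ω => F (S.history π q₀ ω t, ω t)) (pathLaw A)) :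
    ∫ ω, F (S.history π q₀ ω t, ω t) ∂pathLaw A
      = ∫ ω, ∫ x, F (S.history π q₀ ω t, x) ∂slotLaw A ∂pathLaw A := by
  -- Redrawing slot `t` preserves the path law, and the history up to `t` depends only on earlier
  -- slots. So `ω t` may be replaced by an independent copy.
  have hmap : ((pathLaw A).prod (slotLaw A)).map (fun p => Function.update p.1 t p.2)
      = pathLaw A := map_update_infinitePi (slotLaw A) t
  have hm : Measurable fun ω : ℕ → M.Slot => F (S.history π q₀ ω t, ω t) :=
    hF.comp ((S.measurable_history π q₀ t).prodMk (by fun_prop))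
  have hu : Measurable fun p : (ℕ → M.Slot) × M.Slot => Function.update p.1 t p.2 := by
    fun_prop
  have hint' : Integrable (fun p : (ℕ → M.Slot) × M.Slot => F (S.history π q₀ p.1 t, p.2))
      ((pathLaw A).prod (slotLaw A)) := by
    rw [← hmap, integrable_map_measure hm.aestronglyMeasurable hu.aemeasurable] at hint
    simpa only [Function.comp_def, history_update, Function.update_self] using hint
  conv_lhs => rw [← hmap]
  rw [integral_map hu.aemeasurable hm.aestronglyMeasurable]
  simp only [history_update, Function.update_self]
  exact integral_prod _ hint'

lemma abs_meanRate_le (S : M.IAScheme) (ℒ : Finset (Fin M.N)) (k : Fin M.N) :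
    |M.meanRate ℒ k| ≤ M.d * M.R := by
  rw [← S.integral_service, ← Real.norm_eq_abs]
  refine (norm_integral_le_of_norm_le_const (C := M.d * M.R) (ae_of_all _ fun H => ?_)).trans ?_
  · rw [Real.norm_eq_abs, abs_of_nonneg (S.service_nonneg _ _ _)]; exact S.service_le _ _ _
  · simp

lemma abs_service_le (ℒ : Finset (Fin M.N)) (H : M.Channel) (k : Fin M.N) :
    |S.service ℒ H k| ≤ M.d * M.R := by
  rw [abs_of_nonneg (S.service_nonneg _ _ _)]; exact S.service_le _ _ _

lemma integrable_mul_service (A : ArrivalLaw M.N) (t : ℕ) (k : Fin M.N)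
    {g : (ℕ → M.Slot) → ℝ} (hg : Integrable g (pathLaw A)) :
    Integrable (fun ω => g ω * S.service (S.active π q₀ ω t) (ω t).2.1 k) (pathLaw A) :=
  hg.mul_bdd (c := M.d * M.R) (S.measurable_service_active π q₀ t k).aestronglyMeasurable
    (ae_of_all _ fun _ => S.abs_service_le _ _ _)

lemma integrable_mul_meanRate (A : ArrivalLaw M.N) (t : ℕ) (k : Fin M.N)
    {g : (ℕ → M.Slot) → ℝ} (hg : Integrable g (pathLaw A)) :
    Integrable (fun ω => g ω * M.meanRate (S.active π q₀ ω t) k) (pathLaw A) :=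
  hg.mul_bdd (c := M.d * M.R) (S.measurable_meanRate_active π q₀ t k).aestronglyMeasurable
    (ae_of_all _ fun _ => S.abs_meanRate_le _ _)

lemma integrable_mul_arrival (A : ArrivalLaw M.N) (t : ℕ) (k : Fin M.N)
    {g : (ℕ → M.Slot) → ℝ} (hg : Integrable g (pathLaw A)) :
    Integrable (fun ω => g ω * (ω t).1 k) (pathLaw A) := by
  obtain ⟨C, -, hC⟩ := ae_arrival_bounded A
  refine hg.mul_bdd (c := C) (Measurable.aestronglyMeasurable (by fun_prop)) ?_
  filter_upwards [hC] with ω hω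
  rw [Real.norm_eq_abs, abs_of_nonneg (hω t k).1]; exact (hω t k).2

/-- Given the history, the active set depends on the slot only through the seed, so service may be
replaced by mean rate even when weighted by a function of the queues. Constant weights serve the
necessity part and queue lengths the drift bound. -/
lemma integral_mul_service (A : ArrivalLaw M.N) (t : ℕ) (k : Fin M.N)
    {f : (Fin (t + 1) → Fin M.N → ℝ) → ℝ} (hf : Measurable f)
    (hint : Integrable (fun ω => f (S.history π q₀ ω t)) (pathLaw A)) :
    ∫ ω, f (S.history π q₀ ω t) * S.service (S.active π q₀ ω t) (ω t).2.1 k ∂pathLaw A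
      = ∫ ω, f (S.history π q₀ ω t) * M.meanRate (S.active π q₀ ω t) k ∂pathLaw A := by
  have hsel : Measurable fun p : (Fin (t + 1) → Fin M.N → ℝ) × M.Slot =>
      π.select t p.1 p.2.2.2 :=
    (π.measurable_select t).comp (measurable_fst.prodMk (by fun_prop))
  have h1 := S.integral_history_slot π q₀ A t
    (F := fun p => f p.1 * S.service (π.select t p.1 p.2.2.2) p.2.2.1 k)
    ((hf.comp measurable_fst).mul ((S.measurable_service_prod k).comp
      (hsel.prodMk (by fun_prop)))) (S.integrable_mul_service π q₀ A t k hint)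
  have h2 := S.integral_history_slot π q₀ A t
    (F := fun p => f p.1 * M.meanRate (π.select t p.1 p.2.2.2) k)
    ((hf.comp measurable_fst).mul ((measurable_of_countable fun ℒ => M.meanRate ℒ k).comp hsel))
    (S.integrable_mul_meanRate π q₀ A t k hint)
  refine h1.trans (Eq.trans ?_ h2.symm)
  refine integral_congr_ae (ae_of_all _ fun ω => ?_)
  simp only
  rw [integral_const_mul, integral_const_mul, S.integral_service_select A k
    (f := fun s => π.select t (S.history π q₀ ω t) s)
    ((π.measurable_select t).comp (measurable_const.prodMk measurable_id))]

lemma integral_mul_arrival (A : ArrivalLaw M.N) (t : ℕ) (k : Fin M.N)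
    {f : (Fin (t + 1) → Fin M.N → ℝ) → ℝ} (hf : Measurable f)
    (hint : Integrable (fun ω => f (S.history π q₀ ω t)) (pathLaw A)) :
    ∫ ω, f (S.history π q₀ ω t) * (ω t).1 k ∂pathLaw A
      = (∫ ω, f (S.history π q₀ ω t) ∂pathLaw A) * A.mean k := by
  have h1 := S.integral_history_slot π q₀ A t (F := fun p => f p.1 * p.2.1 k)
    ((hf.comp measurable_fst).mul (by fun_prop)) (integrable_mul_arrival A t k hint)
  refine h1.trans ?_
  simp only
  simp_rw [integral_const_mul, integral_arrival]
  rw [integral_mul_const]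

variable {q₀}

/-- At each fixed time the queues are bounded, so every moment used below is finite without any
stability assumption. -/
lemma queue_bounds (hq₀ : ∀ k, 0 ≤ q₀ k) {ω : ℕ → M.Slot} {C : ℝ}
    (hω : ∀ t k, 0 ≤ (ω t).1 k ∧ (ω t).1 k ≤ C) (t : ℕ) (k : Fin M.N) :
    0 ≤ S.queue π q₀ ω t k ∧ S.queue π q₀ ω t k ≤ q₀ k + t * C := by
  induction t with
  | zero => simpa [queue_zero] using hq₀ k
  | succ t ih =>
    rw [queue_succ]
    have h1 := S.service_nonneg (S.active π q₀ ω t) (ω t).2.1 k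
    refine ⟨add_nonneg (le_max_right _ _) (hω t k).1, ?_⟩
    have : max (S.queue π q₀ ω t k - S.service (S.active π q₀ ω t) (ω t).2.1 k) 0
        ≤ S.queue π q₀ ω t k := max_le (by linarith) ih.1
    push_cast
    linarith [ih.2, (hω t k).2]

lemma ae_queue_nonneg (hq₀ : ∀ k, 0 ≤ q₀ k) (A : ArrivalLaw M.N) (t : ℕ) (k : Fin M.N) :
    ∀ᵐ ω ∂pathLaw A, 0 ≤ S.queue π q₀ ω t k := by
  obtain ⟨C, -, hC⟩ := ae_arrival_bounded A
  filter_upwards [hC] with ω hω using (S.queue_bounds π hq₀ hω t k).1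

lemma integrable_queue_pow (hq₀ : ∀ k, 0 ≤ q₀ k) (A : ArrivalLaw M.N) (t : ℕ) (k : Fin M.N)
    (n : ℕ) : Integrable (fun ω => S.queue π q₀ ω t k ^ n) (pathLaw A) := by
  obtain ⟨C, -, hC⟩ := ae_arrival_bounded A
  refine integrable_of_ae_abs_le ((S.measurable_queue π q₀ t k).pow_const n)
    (C := (q₀ k + t * C) ^ n) ?_
  filter_upwards [hC] with ω hω
  have h := S.queue_bounds π hq₀ hω t k
  rw [abs_of_nonneg (pow_nonneg h.1 n)]
  exact pow_le_pow_left₀ h.1 h.2 n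

lemma integrable_queue (hq₀ : ∀ k, 0 ≤ q₀ k) (A : ArrivalLaw M.N) (t : ℕ) (k : Fin M.N) :
    Integrable (fun ω => S.queue π q₀ ω t k) (pathLaw A) := by
  simpa using S.integrable_queue_pow π hq₀ A t k 1

lemma lintegral_queue (hq₀ : ∀ k, 0 ≤ q₀ k) (A : ArrivalLaw M.N) (t : ℕ) (k : Fin M.N) :
    ∫⁻ ω, ENNReal.ofReal (S.queue π q₀ ω t k) ∂pathLaw A
      = ENNReal.ofReal (∫ ω, S.queue π q₀ ω t k ∂pathLaw A) :=
  (ofReal_integral_eq_lintegral_ofReal (S.integrable_queue π hq₀ A t k)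
    (S.ae_queue_nonneg π hq₀ A t k)).symm

lemma integral_queue_nonneg (hq₀ : ∀ k, 0 ≤ q₀ k) (A : ArrivalLaw M.N) (t : ℕ) (k : Fin M.N) :
    0 ≤ ∫ ω, S.queue π q₀ ω t k ∂pathLaw A :=
  integral_nonneg_of_ae (S.ae_queue_nonneg π hq₀ A t k)

/-- Time-averaged expected queue lengths as a real number. -/
lemma average_lintegral_queue (hq₀ : ∀ k, 0 ≤ q₀ k) (A : ArrivalLaw M.N) {T : ℕ} (hT : 0 < T)
    (k : Fin M.N) :
    (∑ t ∈ Finset.range T, ∫⁻ ω, ENNReal.ofReal (S.queue π q₀ ω t k) ∂pathLaw A) / (T : ENNReal)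
      = ENNReal.ofReal ((∑ t ∈ Finset.range T, ∫ ω, S.queue π q₀ ω t k ∂pathLaw A) / T) := by
  simp_rw [S.lintegral_queue π hq₀ A]
  rw [← ENNReal.ofReal_sum_of_nonneg fun t _ => S.integral_queue_nonneg π hq₀ A t k,
    ENNReal.ofReal_div_of_pos (Nat.cast_pos.2 hT), ENNReal.ofReal_natCast]

end IAScheme

end SymmetricSystem

/-! ### Necessity -/

/-- Measurable choice of a maximizer among finitely many measurable functions. -/
lemma exists_measurable_argmax {X ι : Type*} [MeasurableSpace X] [MeasurableSpace ι] [Countable ι]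
    [MeasurableSingletonClass ι] {f : ι → X → ℝ} (hf : ∀ i, Measurable (f i)) {s : Finset ι}
    (hs : s.Nonempty) : ∃ g : X → ι, Measurable g ∧ ∀ x, ∀ i ∈ s, f i x ≤ f (g x) x := by
  classical
  induction hs using Finset.Nonempty.cons_induction with
  | singleton i => exact ⟨fun _ => i, measurable_const, by simp⟩
  | cons i s hi hs ih =>
    obtain ⟨g, hg, hmax⟩ := ih
    have hfg : Measurable fun x => f (g x) x :=
      (measurable_from_prod_countable_right (f := fun p : ι × X => f p.1 p.2) hf).comp
        (hg.prodMk measurable_id)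
    refine ⟨fun x => if f (g x) x ≤ f i x then i else g x,
      Measurable.ite (measurableSet_le hfg (hf i)) measurable_const hg, fun x j hj => ?_⟩
    rcases Finset.mem_cons.1 hj with rfl | hj
    · dsimp only
      split_ifs with h
      · exact le_rfl
      · exact (not_le.1 h).le
    · dsimp only
      split_ifs with h
      · exact (hmax x j hj).trans h
      · exact hmax x j hj

/-- A sequence with bounded averages is frequently below any linear function. -/
lemma exists_le_mul_of_average_bounded {w : ℕ → ℝ} (hw : 0 ≤ w 0) {C : ℝ}
    (h : ∀ᶠ T : ℕ in atTop, ∑ t ∈ Finset.range T, w t ≤ C * T) {ε : ℝ} (hε : 0 < ε) :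
    ∃ T : ℕ, 0 < T ∧ w T ≤ ε * T := by
  by_contra! hcon
  -- If `w T > ε T` for all positive `T`, the partial sums grow quadratically, which contradicts the
  -- linear bound.
  have hsum : ∀ T : ℕ, ε * (T * (T - 1) / 2) ≤ ∑ t ∈ Finset.range T, w t := by
    intro T
    induction T with
    | zero => simp
    | succ T ih =>
      rw [Finset.sum_range_succ]
      have hT : ε * T ≤ w T := by
        rcases Nat.eq_zero_or_pos T with rfl | hT
        · simpa using hw
        · exact (hcon T hT).le
      push_cast
      linarith
  obtain ⟨T₁, hT₁⟩ := exists_nat_gt (2 * C / ε + 1)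
  obtain ⟨T, hT, h1, h2⟩ := (h.and ((eventually_ge_atTop T₁).and (eventually_gt_atTop 0))).exists
  have h3 : 2 * C / ε + 1 < T := hT₁.trans_le (Nat.cast_le.2 h1)
  have h4 : 2 * C < ε * (T - 1) := by
    have := (div_lt_iff₀ hε).1 (by linarith : 2 * C / ε < T - 1)
    linarith
  have h5 : (0 : ℝ) < T := Nat.cast_pos.2 h2
  have := (hsum T).trans hT
  nlinarith [mul_lt_mul_of_pos_right h4 h5]

namespace SymmetricSystem

variable {M : SymmetricSystem}

namespace IAScheme

variable (S : M.IAScheme) (π : Policy M.N) {q₀ : Fin M.N → ℝ}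

lemma integrable_meanRate_active (A : ArrivalLaw M.N) (t : ℕ) (k : Fin M.N) :
    Integrable (fun ω => M.meanRate (S.active π q₀ ω t) k) (pathLaw A) := by
  simpa using S.integrable_mul_meanRate π q₀ A t k (integrable_const (1 : ℝ))

lemma integrable_service_active (A : ArrivalLaw M.N) (t : ℕ) (k : Fin M.N) :
    Integrable (fun ω => S.service (S.active π q₀ ω t) (ω t).2.1 k) (pathLaw A) := by
  simpa using S.integrable_mul_service π q₀ A t k (integrable_const (1 : ℝ))

/-- Dropping the truncation at 0 can only lower the queue. -/
lemma integral_queue_succ_ge (hq₀ : ∀ k, 0 ≤ q₀ k) (A : ArrivalLaw M.N) (t : ℕ) (k : Fin M.N) :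
    ∫ ω, S.queue π q₀ ω t k ∂pathLaw A + A.mean k
      - ∫ ω, M.meanRate (S.active π q₀ ω t) k ∂pathLaw A
      ≤ ∫ ω, S.queue π q₀ ω (t + 1) k ∂pathLaw A := by
  have h1 : ∫ ω, S.service (S.active π q₀ ω t) (ω t).2.1 k ∂pathLaw A
      = ∫ ω, M.meanRate (S.active π q₀ ω t) k ∂pathLaw A := by
    simpa using S.integral_mul_service π q₀ A t k (f := fun _ => 1) measurable_const
      (integrable_const _)
  have h2 : ∫ ω, (ω t).1 k ∂pathLaw A = A.mean k := by
    simpa using S.integral_mul_arrival π q₀ A t k (f := fun _ => 1) measurable_const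
      (integrable_const _)
  have i1 := S.integrable_queue π hq₀ A t k
  have i2 : Integrable (fun ω : ℕ → M.Slot => (ω t).1 k) (pathLaw A) := by
    simpa using integrable_mul_arrival A t k (integrable_const (1 : ℝ))
  have i3 := S.integrable_service_active π (q₀ := q₀) A t k
  have i4 : Integrable (fun ω : ℕ → M.Slot => S.queue π q₀ ω t k + (ω t).1 k) (pathLaw A) :=
    i1.add i2
  rw [← h1, ← h2, ← integral_add i1 i2, ← integral_sub i4 i3]
  refine integral_mono (i4.sub i3) (S.integrable_queue π hq₀ A (t + 1) k) fun ω => ?_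
  simp only [queue_succ]
  linarith [le_max_left (S.queue π q₀ ω t k - S.service (S.active π q₀ ω t) (ω t).2.1 k) 0]

/-- Necessity: the mean arrival vector of a stabilizable law belongs to `Λ_P`. -/
theorem mean_mem_regionP_of_stabilizable (hq₀ : ∀ k, 0 ≤ q₀ k) {A : ArrivalLaw M.N}
    (h : S.Stabilizable q₀ A) : A.mean ∈ M.regionP := by
  obtain ⟨π, hπ⟩ := h
  set Q : ℕ → Fin M.N → ℝ := fun t k => ∫ ω, S.queue π q₀ ω t k ∂pathLaw A with hQ
  set r : ℕ → Fin M.N → ℝ := fun t => ∫ ω, M.meanRate (S.active π q₀ ω t) ∂pathLaw A with hr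
  have hQ0 : ∀ t k, 0 ≤ Q t k := fun t k => S.integral_queue_nonneg π hq₀ A t k
  have hrmem : ∀ t, r t ∈ M.regionP := fun t =>
    M.convex_regionP.integral_mem M.isClosed_regionP
      (ae_of_all _ fun ω => M.meanRate_mem_regionP _)
      (Integrable.of_eval fun k => S.integrable_meanRate_active π A t k)
  have hstep : ∀ t k, Q t k + A.mean k - r t k ≤ Q (t + 1) k := fun t k => by
    have := S.integral_queue_succ_ge π hq₀ A t k
    rwa [← eval_integral fun k => S.integrable_meanRate_active π A t k] at this
  have hbound : ∀ k, ∃ C : ℝ, ∀ᶠ T : ℕ in atTop, ∑ t ∈ Finset.range T, Q t k ≤ C * T := by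
    intro k
    obtain ⟨C, hC1, hC2⟩ := ENNReal.lt_iff_exists_nnreal_btwn.1 (hπ k)
    refine ⟨C, ?_⟩
    filter_upwards [eventually_lt_of_limsup_lt hC1, eventually_gt_atTop 0] with T hT hT0
    rw [S.average_lintegral_queue π hq₀ A hT0] at hT
    have hT' := (ENNReal.ofReal_lt_coe_iff (div_nonneg (Finset.sum_nonneg fun t _ => hQ0 t k)
      (Nat.cast_nonneg _))).1 hT
    exact ((div_lt_iff₀ (Nat.cast_pos.2 hT0)).1 hT').le
  choose C hC using hbound
  have hW : ∀ᶠ T : ℕ in atTop, ∑ t ∈ Finset.range T, ∑ k, Q t k ≤ (∑ k, C k) * T := by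
    filter_upwards [eventually_all.2 hC] with T hT
    rw [Finset.sum_comm, Finset.sum_mul]
    exact Finset.sum_le_sum fun k _ => hT k
  -- At a time `T` when the total expected queue is at most `ε T`, telescoping gives `A.mean k - ε
  -- ≤` the time average of the rates. The maximum with 0 keeps the vector in the orthant, where Λ_P
  -- is a lower set.
  have hclose : ∀ ε > 0, (fun k => max (A.mean k - ε) 0) ∈ M.regionP := by
    intro ε hε
    obtain ⟨T, hT0, hT⟩ := exists_le_mul_of_average_bounded
      (w := fun t => ∑ k, Q t k) (Finset.sum_nonneg fun k _ => hQ0 0 k) hW hε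
    have hTr : (0 : ℝ) < T := Nat.cast_pos.2 hT0
    have hrbar : ∑ t ∈ Finset.range T, (1 / (T : ℝ)) • r t ∈ M.regionP :=
      M.convex_regionP.sum_mem (fun _ _ => by positivity) (by simp [hTr.ne'])
        fun t _ => hrmem t
    refine M.mem_regionP_of_le hrbar (fun k => le_max_right _ _) fun k => max_le ?_
      (M.nonneg_of_mem_regionP hrbar k)
    have htele : ∀ n : ℕ, n * A.mean k - ∑ t ∈ Finset.range n, r t k ≤ Q n k := by
      intro n
      induction n with
      | zero => simpa using hQ0 0 k
      | succ n ih =>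
        rw [Finset.sum_range_succ]
        push_cast
        linarith [hstep n k]
    have hQT : Q T k ≤ ε * T :=
      (Finset.single_le_sum (fun k _ => hQ0 T k) (Finset.mem_univ k)).trans hT
    rw [Finset.sum_apply]
    simp only [Pi.smul_apply, smul_eq_mul, ← Finset.mul_sum]
    rw [one_div, ← div_eq_inv_mul, le_div_iff₀ hTr]
    linarith [htele T]
  have hlim : Tendsto (fun ε : ℝ => fun k => max (A.mean k - ε) 0) (𝓝[>] 0) (𝓝 A.mean) := by
    have hc : Continuous fun ε : ℝ => fun k => max (A.mean k - ε) 0 := by fun_prop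
    have := hc.tendsto 0
    simp only [sub_zero, max_eq_left (A.mean_nonneg _)] at this
    exact this.mono_left nhdsWithin_le_nhds
  exact M.isClosed_regionP.mem_of_tendsto hlim
    (eventually_nhdsWithin_of_forall fun ε hε => hclose ε hε)

/-! ### Sufficiency: quadratic drift and max-weight scheduling -/

/-- The drift of the squared queue length. -/
lemma integral_queue_sq_succ_le (hq₀ : ∀ k, 0 ≤ q₀ k) (A : ArrivalLaw M.N) :
    ∃ D : ℝ, 0 ≤ D ∧ ∀ t k, ∫ ω, S.queue π q₀ ω (t + 1) k ^ 2 ∂pathLaw A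
      ≤ ∫ ω, S.queue π q₀ ω t k ^ 2 ∂pathLaw A + D
        + 2 * (A.mean k * ∫ ω, S.queue π q₀ ω t k ∂pathLaw A)
        - 2 * ∫ ω, S.queue π q₀ ω t k * M.meanRate (S.active π q₀ ω t) k ∂pathLaw A := by
  obtain ⟨C, hC0, hC⟩ := ae_arrival_bounded A
  -- The second-order terms B² and A² of the drift are bounded by these constants, as B ≤ dR and A ≤
  -- C almost surely.
  refine ⟨(M.d * M.R) ^ 2 + C ^ 2, by positivity, fun t k => ?_⟩
  have i1 := S.integrable_queue π hq₀ A t k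
  have i2 := S.integrable_queue_pow π hq₀ A t k 2
  have i3 := S.integrable_mul_service π q₀ A t k i1
  have i4 := integrable_mul_arrival A t k i1
  have hmeas : Measurable fun h : Fin (t + 1) → Fin M.N → ℝ => h (Fin.last t) k := by fun_prop
  have h1 : ∫ ω, S.queue π q₀ ω t k * S.service (S.active π q₀ ω t) (ω t).2.1 k ∂pathLaw A
      = ∫ ω, S.queue π q₀ ω t k * M.meanRate (S.active π q₀ ω t) k ∂pathLaw A :=
    S.integral_mul_service π q₀ A t k hmeas i1
  have h2 : ∫ ω, S.queue π q₀ ω t k * (ω t).1 k ∂pathLaw A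
      = (∫ ω, S.queue π q₀ ω t k ∂pathLaw A) * A.mean k :=
    S.integral_mul_arrival π q₀ A t k hmeas i1
  have hle : ∫ ω, S.queue π q₀ ω (t + 1) k ^ 2 ∂pathLaw A
      ≤ ∫ ω, (S.queue π q₀ ω t k ^ 2 + ((M.d * M.R) ^ 2 + C ^ 2)
        + 2 * (S.queue π q₀ ω t k * (ω t).1 k)
        - 2 * (S.queue π q₀ ω t k * S.service (S.active π q₀ ω t) (ω t).2.1 k)) ∂pathLaw A := by
    refine integral_mono_ae (S.integrable_queue_pow π hq₀ A (t + 1) k 2)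
      (((i2.add (integrable_const _)).add (i4.const_mul 2)).sub (i3.const_mul 2)) ?_
    filter_upwards [hC] with ω hω
    have hq := (S.queue_bounds π hq₀ hω t k).1
    have hB := S.service_nonneg (S.active π q₀ ω t) (ω t).2.1 k
    have hB' := S.service_le (S.active π q₀ ω t) (ω t).2.1 k
    obtain ⟨hA, hA'⟩ := hω t k
    simp only [queue_succ]
    set q := S.queue π q₀ ω t k
    set B := S.service (S.active π q₀ ω t) (ω t).2.1 k
    set a := (ω t).1 k
    have e1 : (max (q - B) 0) ^ 2 ≤ (q - B) ^ 2 := by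
      rcases le_total (q - B) 0 with h | h
      · rw [max_eq_right h]; simpa using sq_nonneg (q - B)
      · rw [max_eq_left h]
    have e2 : a * max (q - B) 0 ≤ a * q :=
      mul_le_mul_of_nonneg_left (max_le (by linarith) hq) hA
    have e3 : B ^ 2 ≤ (M.d * M.R) ^ 2 := pow_le_pow_left₀ hB hB' 2
    have e4 : a ^ 2 ≤ C ^ 2 := pow_le_pow_left₀ hA hA' 2
    linarith [show (max (q - B) 0 + a) ^ 2 = (max (q - B) 0) ^ 2 + 2 * (a * max (q - B) 0) + a ^ 2
      by ring, show (q - B) ^ 2 = q ^ 2 - 2 * (q * B) + B ^ 2 by ring]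
  refine hle.trans_eq ?_
  have i5 : Integrable (fun ω => S.queue π q₀ ω t k ^ 2 + ((M.d * M.R) ^ 2 + C ^ 2))
      (pathLaw A) := i2.add (integrable_const _)
  have i6 : Integrable (fun ω => S.queue π q₀ ω t k ^ 2 + ((M.d * M.R) ^ 2 + C ^ 2)
      + 2 * (S.queue π q₀ ω t k * (ω t).1 k)) (pathLaw A) := i5.add (i4.const_mul 2)
  rw [integral_sub i6 (i3.const_mul 2), integral_add i5 (i4.const_mul 2),
    integral_add i2 (integrable_const _), integral_const_mul, integral_const_mul, h1, h2]
  simp [mul_comm]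

/-- A max-weight rule that maps queue lengths to the active set of largest weighted rate. -/
lemma exists_maxWeight (M : SymmetricSystem) : ∃ g : (Fin M.N → ℝ) → Finset (Fin M.N),
    Measurable g ∧ ∀ q, ∀ x ∈ M.regionP, ∑ k, q k * x k ≤ ∑ k, q k * M.meanRate (g q) k := by
  obtain ⟨g, hg, hmax⟩ := exists_measurable_argmax
    (f := fun ℒ (q : Fin M.N → ℝ) => ∑ k, q k * M.meanRate ℒ k) (fun ℒ => by fun_prop)
    (Finset.univ_nonempty (α := Finset (Fin M.N)))
  refine ⟨g, hg, fun q x hx => ?_⟩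
  -- A linear functional that is bounded on the rate vectors of all active sets has the same bound
  -- on Λ_P.
  have hsub : M.regionP ⊆ {x | ∑ k, q k * x k ≤ ∑ k, q k * M.meanRate (g q) k} := by
    refine M.regionP_subset (convex_halfSpace_le ⟨fun x y => ?_, fun c x => ?_⟩ _)
      (isClosed_le (by fun_prop) continuous_const) fun ℒ => hmax q ℒ (Finset.mem_univ _)
    · simp [mul_add, Finset.sum_add_distrib]
    · simp [Finset.mul_sum, mul_left_comm]
  exact hsub hx

/-- Sufficiency: max-weight scheduling stabilizes every arrival law whose mean vector lies in
`Λ_P` with some slack. -/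
theorem stabilizable_of_add_mem_regionP (hq₀ : ∀ k, 0 ≤ q₀ k) (A : ArrivalLaw M.N) {ε : ℝ}
    (hε : 0 < ε) (h : (fun k => A.mean k + ε) ∈ M.regionP) : S.Stabilizable q₀ A := by
  obtain ⟨g, hg, hmax⟩ := exists_maxWeight M
  let π : Policy M.N :=
    { select := fun t h _ => g (h (Fin.last t))
      measurable_select := fun t => hg.comp (by fun_prop) }
  refine ⟨π, fun k => ?_⟩
  obtain ⟨D, hD0, hD⟩ := S.integral_queue_sq_succ_le π hq₀ A
  set Q : ℕ → Fin M.N → ℝ := fun t k => ∫ ω, S.queue π q₀ ω t k ∂pathLaw A with hQ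
  set V : ℕ → ℝ := fun t => ∑ k, ∫ ω, S.queue π q₀ ω t k ^ 2 ∂pathLaw A with hV
  have hQ0 : ∀ t k, 0 ≤ Q t k := fun t k => S.integral_queue_nonneg π hq₀ A t k
  have hV0 : ∀ t, 0 ≤ V t := fun t =>
    Finset.sum_nonneg fun k _ => integral_nonneg fun ω => sq_nonneg _
  have hweight : ∀ t, ∑ k, Q t k * (A.mean k + ε)
      ≤ ∑ k, ∫ ω, S.queue π q₀ ω t k * M.meanRate (S.active π q₀ ω t) k ∂pathLaw A := by
    intro t
    have i1 : ∀ k ∈ Finset.univ, Integrable (fun ω => S.queue π q₀ ω t k * (A.mean k + ε))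
        (pathLaw A) := fun k _ => (S.integrable_queue π hq₀ A t k).mul_const _
    have i2 : ∀ k ∈ Finset.univ, Integrable
        (fun ω => S.queue π q₀ ω t k * M.meanRate (S.active π q₀ ω t) k) (pathLaw A) :=
      fun k _ => S.integrable_mul_meanRate π q₀ A t k (S.integrable_queue π hq₀ A t k)
    simp only [hQ, ← integral_mul_const]
    rw [← integral_finsetSum _ i1, ← integral_finsetSum _ i2]
    exact integral_mono (integrable_finsetSum _ i1) (integrable_finsetSum _ i2)
      fun ω => hmax (S.queue π q₀ ω t) _ h
  -- Max-weight does at least as well as the point `A.mean + ε` of Λ_P. The arrival terms cancel and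
  -- only the slack remains.
  have hdrift : ∀ t, V (t + 1) ≤ V t + M.N * D - 2 * ε * ∑ k, Q t k := by
    intro t
    have h1 := Finset.sum_le_sum fun k (_ : k ∈ Finset.univ) => hD t k
    simp only [Finset.sum_sub_distrib, Finset.sum_add_distrib, ← Finset.mul_sum, Finset.sum_const,
      Finset.card_univ, Fintype.card_fin, nsmul_eq_mul] at h1
    have h2 := hweight t
    simp only [mul_add, Finset.sum_add_distrib, ← Finset.sum_mul] at h2
    have h3 : ∑ k, Q t k * A.mean k = ∑ k, A.mean k * Q t k :=
      Finset.sum_congr rfl fun k _ => mul_comm _ _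
    simp only [hV, hQ] at h1 h2 h3 ⊢
    linarith
  have htele : ∀ T : ℕ, V T + 2 * ε * ∑ t ∈ Finset.range T, ∑ k, Q t k ≤ V 0 + T * (M.N * D) := by
    intro T
    induction T with
    | zero => simp
    | succ T ih =>
      rw [Finset.sum_range_succ]
      push_cast
      linarith [hdrift T]
  -- The telescoped drift bounds the average by (V(0)/T + N D)/(2ε), and T ≥ 1 makes this uniform in
  -- T.
  refine lt_of_le_of_lt (b := ENNReal.ofReal ((V 0 + M.N * D) / (2 * ε))) ?_ ENNReal.ofReal_lt_top
  refine limsup_le_of_le (by isBoundedDefault) ?_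
  filter_upwards [eventually_gt_atTop 0] with T hT0
  rw [S.average_lintegral_queue π hq₀ A hT0]
  refine ENNReal.ofReal_le_ofReal ?_
  have hTr : (1 : ℝ) ≤ T := Nat.one_le_cast.2 hT0
  rw [div_le_div_iff₀ (by linarith) (by positivity)]
  have h1 : ∑ t ∈ Finset.range T, Q t k ≤ ∑ t ∈ Finset.range T, ∑ k, Q t k :=
    Finset.sum_le_sum fun t _ => Finset.single_le_sum (fun k _ => hQ0 t k) (Finset.mem_univ k)
  have h2 := mul_le_mul_of_nonneg_left h1 (by positivity : 0 ≤ 2 * ε)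
  have h3 := mul_le_mul_of_nonneg_left hTr (hV0 0)
  have h4 := htele T
  have h5 := hV0 T
  simp only [hQ] at h2 h4 ⊢
  linarith

/-! ### Interior and closure of the stability region -/

lemma mem_stabilityRegion_of_mem_nhdsWithin (hq₀ : ∀ k, 0 ≤ q₀ k) {a : Fin M.N → ℝ}
    (ha : ∀ k, 0 ≤ a k) (h : M.regionP ∈ 𝓝[{b | ∀ k, 0 ≤ b k}] a) :
    a ∈ S.stabilityRegion q₀ := by
  obtain ⟨ε, hε, hmem⟩ := M.exists_add_mem_regionP ha h
  refine ⟨ha, fun A hA => S.stabilizable_of_add_mem_regionP hq₀ A hε ?_⟩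
  rwa [hA]

/-- The deterministic arrival law with rates `a`. -/
def diracArrival {N : ℕ} (a : Fin N → ℝ) (ha : ∀ k, 0 ≤ a k) : ArrivalLaw N where
  law k := Measure.dirac (a k)
  prob _ := inferInstance
  bounded := ⟨∑ k, a k + 1, fun k => by
    refine (ae_dirac_iff (p := fun x => 0 ≤ x ∧ x < ∑ k, a k + 1)
      (measurableSet_Ici.inter measurableSet_Iio)).2 ?_
    exact ⟨ha k, (Finset.single_le_sum (fun k _ => ha k) (Finset.mem_univ k)).trans_lt
      (lt_add_one _)⟩⟩

lemma diracArrival_mean {N : ℕ} (a : Fin N → ℝ) (ha : ∀ k, 0 ≤ a k) :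
    (diracArrival a ha).mean = a := by
  ext k; simp [ArrivalLaw.mean, diracArrival]

/-- A point of the stability region must be stabilizable for deterministic arrivals, so necessity
applies to it. Conversely, `(1 - δ) a` is relatively interior for each `a` in Λ_P and tends to `a`.
-/
lemma closure_stabilityRegion (hq₀ : ∀ k, 0 ≤ q₀ k) :
    closure (S.stabilityRegion q₀) = M.regionP := by
  refine Set.Subset.antisymm (closure_minimal (fun a ha => ?_) M.isClosed_regionP) fun a ha => ?_
  · have := S.mean_mem_regionP_of_stabilizable hq₀ (ha.2 _ (diracArrival_mean a ha.1))
    rwa [diracArrival_mean] at this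
  · have hlim : Tendsto (fun δ : ℝ => (1 - δ) • a) (𝓝[>] 0) (𝓝 a) := by
      have hc : Continuous fun δ : ℝ => (1 - δ) • a := by fun_prop
      have := hc.tendsto 0
      simp only [sub_zero, one_smul] at this
      exact this.mono_left nhdsWithin_le_nhds
    refine mem_closure_of_tendsto hlim ?_
    filter_upwards [Ioo_mem_nhdsGT (zero_lt_one (α := ℝ))] with δ hδ
    exact S.mem_stabilityRegion_of_mem_nhdsWithin hq₀
      (fun k => mul_nonneg (by linarith [hδ.2]) (M.nonneg_of_mem_regionP ha k))
      (M.regionP_mem_nhdsWithin_smul ha hδ.1 hδ.2.le)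

end IAScheme

end SymmetricSystem
end

end IAStability

theorem mainTheorem2 (M : IAStability.SymmetricSystem) (S : M.IAScheme)
    (q₀ : Fin M.N → ℝ) (hq₀ : ∀ k, 0 ≤ q₀ k) :
    closure (S.stabilityRegion q₀) = M.regionP ∧
    (∀ a : Fin M.N → ℝ, (∀ k, 0 ≤ a k) → M.regionP ∈ 𝓝[{b | ∀ k, 0 ≤ b k}] a →
      a ∈ S.stabilityRegion q₀) ∧
    (∀ A : IAStability.ArrivalLaw M.N, S.Stabilizable q₀ A → A.mean ∈ M.regionP) :=
  ⟨S.closure_stabilityRegion hq₀, fun _ ha h => S.mem_stabilityRegion_of_mem_nhdsWithin hq₀ ha h,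
    fun _ h => S.mean_mem_regionP_of_stabilizable hq₀ h⟩
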